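/- For each $n\ge 1$ let $\pi_n$ be a uniformly distributed random permutation of $\{1,\dots,n\}$. Let $D_n=\#\{1\le i\le n-1:\pi_n(i)>\pi_n(i+1)\}$ be the number of descents of $\pi_n$, and let $D'_n$ be the number of descents of the inverse permutation $\pi_n^{-1}$. Let $L(t)=\log\left(\frac{e^t-1}{t}\right)$ for $t\in\mathbb{R}\setminus\{0\}$ and $L(0)=0$. For all $x,y\in\left]\tfrac12,1\right[$, the equations $L'(t)=x$ and $L'(t)=y$ have unique real solutions, denoted $t_x$ and $t_y$, and, as $n\to\infty$, \begin{align*} \mathbb{P}\Big(\tfrac{D_n}{n-1}\ge x,\ \tfrac{D'_n}{n-1}\ge y\Big)&=\mathbb{P}\Big(\tfrac{D_n}{n-1}\ge x\Big)\,\mathbb{P}\Big(\tfrac{D'_n}{n-1}\ge y\Big)\exp\Big(\frac{t_xt_y}{2}\Big)[1+o(1)],\\ \mathbb{P}\Big(\tfrac{D_n}{n-1}\le 1-x,\ \tfrac{D'_n}{n-1}\le 1-y\Big)&=\mathbb{P}\Big(\tfrac{D_n}{n-1}\le 1-x\Big)\,\mathbb{P}\Big(\tfrac{D'_n}{n-1}\le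 1-y\Big)\exp\Big(\frac{t_xt_y}{2}\Big)[1+o(1)],\\ \mathbb{P}\Big(\tfrac{D_n}{n-1}\le 1-x,\ \tfrac{D'_n}{n-1}\ge y\Big)&=\mathbb{P}\Big(\tfrac{D_n}{n-1}\le 1-x\Big)\,\mathbb{P}\Big(\tfrac{D'_n}{n-1}\ge y\Big)\exp\Big(-\frac{t_xt_y}{2}\Big)[1+o(1)],\\ \mathbb{P}\Big(\tfrac{D_n}{n-1}\ge x,\ \tfrac{D'_n}{n-1}\le 1-y\Big)&=\mathbb{P}\Big(\tfrac{D_n}{n-1}\ge x\Big)\,\mathbb{P}\Big(\tfrac{D'_n}{n-1}\le 1-y\Big)\exp\Big(-\frac{t_xt_y}{2}\Big)[1+o(1)]. \end{align*} -/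

import Mathlib

open MeasureTheory Filter Asymptotics

/-- The number of descents of a permutation `σ` of `n` letters: the number of positions `i`
such that `i + 1` is again a position and `σ (i + 1) < σ i`. (Letters are numbered from `0`.) -/
def descents {n : ℕ} (σ : Equiv.Perm (Fin n)) : ℕ :=
  (Finset.univ.filter fun i : Fin n => ∃ h : (i : ℕ) + 1 < n, σ ⟨(i : ℕ) + 1, h⟩ < σ i).card

/-- The random permutation `π` is uniformly distributed: each of the `n!` permutations
is taken with probability `1 / n!`. -/
def IsUniformPerm {Ω : Type*} [MeasurableSpace Ω] (μ : Measure Ω) {n : ℕ}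
    (π : Ω → Equiv.Perm (Fin n)) : Prop :=
  ∀ σ : Equiv.Perm (Fin n), MeasurableSet (π ⁻¹' {σ}) ∧ μ (π ⁻¹' {σ}) = (n.factorial : ENNReal)⁻¹

/-- `D_n / (n - 1)`, where `D_n` is the number of descents of `σ`. -/
noncomputable def descentRatio {n : ℕ} (σ : Equiv.Perm (Fin n)) : ℝ :=
  (descents σ : ℝ) / ((n : ℝ) - 1)

/-- `L(t) = log ((exp t - 1) / t)`, extended by continuity by `L(0) = 0`. -/
noncomputable def logLaplaceUnif (t : ℝ) : ℝ :=
  if t = 0 then 0 else Real.log ((Real.exp t - 1) / t)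

/-!
The argument writes the joint law of the two descent numbers as a finite sum of products of
marginal quantities, and shows that, relative to the product of the marginals, this sum tends to an
exponential series.

Let `∇` be the backward difference. A weakly increasing word in the letters `[k] × [l]`, ordered
lexicographically, is the same as a permutation `σ` with a word in `[k]` compatible with `σ` and a
word in `[l]` compatible with `σ⁻¹` (`sum_card_gapWords_mul`). There are `(kl)(kl+1)⋯(kl+n-1) / n!`
such words, which expands through Stirling numbers into `∑ j, c(n, n-j) k^(n-j) l^(n-j) / n!`. The
number of words compatible with `σ` is an `n`-fold sum of the indicator of `k > des σ`. Hence, after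
applying `∇^n` in both variables, with `H_m = ∇^m (k ↦ k^m)` (`cumEuler`),
`n! #{σ | des σ < a, des σ⁻¹ < b} = ∑ j, c(n, n-j) (∇^j H_{n-j})(a) (∇^j H_{n-j})(b)`
(`factorial_mul_card_descents_lt_lt`), and similarly `#{σ | des σ < a} = H_n(a)`. Since
`H_m(a) + H_m(m-a) = m!`, the three other corners are described by the same sum, with a factor
`(-1)^j` in the mixed cases (`jointSum`).

Let `a ~ (1 - x) n`. The recurrence for `H` (`cumEuler_succ_succ`) shows that `H_n` is log-concave.
The generating function `∑ a, H_n(a) e^(-σ a)` is of order `n! exp(n L(-σ))`, and a Chernoff bound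
combined with log-concavity locates the maximum of `a ↦ H_n(a) e^(-σ a)` near `n L'(-σ) = n (1 - L'(σ))`; so
`H_n(a-1) / H_n(a) → e^(-t_x)` (`tendsto_cumEuler_div_succ`). By the recurrence again,
`n H_{n-1}(a) / H_n(a) → t_x / (1 - e^(-t_x))`, and thus `n^j (∇^j H_{n-j})(a) / H_n(a) → t_x^j`
(`tendsto_relDiff`). As `c(n, n-j) / n^(2j) → 1 / (2^j j!)`, the `j`-th term of the sum relative to
`H_n(a) H_n(b)` tends to `(± t_x t_y / 2)^j / j!`. Bounds of the form `C^j / j!`, uniform in `n`,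
follow from the recurrence (`abs_relDiff_le`, `stirlingWeight_le`) and allow the limit to be taken
term by term (`tendsto_jointSum_div`).
-/

/-! ### Backward differences of sequences -/

/-- The shift `(S f)(k) = f(k-1)` on sequences, with `(S f)(0) = 0`. -/
def seqShift : Module.End ℝ (ℕ → ℝ) where
  toFun f k := match k with
    | 0 => 0
    | k + 1 => f k
  map_add' f g := by ext k; cases k <;> simp
  map_smul' c f := by ext k; cases k <;> simp

/-- The backward difference `(∇ f)(k) = f(k) - f(k-1)` on sequences, with `f(-1) = 0`. -/
def bdiff : Module.End ℝ (ℕ → ℝ) := 1 - seqShift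

/-- Multiplication of a sequence by its index. -/
def mulIndex : Module.End ℝ (ℕ → ℝ) where
  toFun f k := k * f k
  map_add' f g := by ext k; simp [mul_add]
  map_smul' c f := by ext k; simp; ring

@[simp] lemma seqShift_zero (f : ℕ → ℝ) : seqShift f 0 = 0 := rfl
@[simp] lemma seqShift_succ (f : ℕ → ℝ) (k : ℕ) : seqShift f (k + 1) = f k := rfl
@[simp] lemma mulIndex_apply (f : ℕ → ℝ) (k : ℕ) : mulIndex f k = k * f k := rfl

@[simp] lemma bdiff_zero (f : ℕ → ℝ) : bdiff f 0 = f 0 := by simp [bdiff]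

@[simp] lemma bdiff_succ (f : ℕ → ℝ) (k : ℕ) : bdiff f (k + 1) = f (k + 1) - f k := by
  simp [bdiff]

lemma bdiff_pow_succ_apply (j : ℕ) (f : ℕ → ℝ) (k : ℕ) :
    (bdiff ^ (j + 1)) f (k + 1) = (bdiff ^ j) f (k + 1) - (bdiff ^ j) f k := by
  rw [pow_succ', Module.End.mul_apply, bdiff_succ]

lemma bdiff_commute_seqShift : Commute bdiff seqShift := by
  unfold bdiff
  exact (Commute.one_left _).sub_left (Commute.refl _)

/-- The product rule for `∇`, as a commutation relation. -/
lemma bdiff_mul_mulIndex : bdiff * mulIndex = mulIndex * bdiff + seqShift := by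
  ext f k
  cases k with
  | zero => simp
  | succ k => simp; ring

lemma bdiff_pow_mul_mulIndex (n : ℕ) :
    bdiff ^ (n + 1) * mulIndex =
      mulIndex * bdiff ^ (n + 1) + ((n : ℝ) + 1) • (seqShift * bdiff ^ n) := by
  induction n with
  | zero => simp [bdiff_mul_mulIndex]
  | succ n ih =>
    rw [pow_succ' bdiff (n + 1), mul_assoc, ih, mul_add, ← mul_assoc, bdiff_mul_mulIndex,
      mul_smul_comm, ← mul_assoc bdiff, bdiff_commute_seqShift.eq, mul_assoc seqShift,
      ← pow_succ' bdiff n, add_mul, mul_assoc, ← pow_succ']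
    push_cast
    module

lemma abs_bdiff_pow_le {f : ℕ → ℝ} {k : ℕ} {C : ℝ} (h : ∀ i ≤ k, |f i| ≤ C) (j : ℕ) :
    |(bdiff ^ j) f k| ≤ 2 ^ j * C := by
  induction j generalizing k with
  | zero => simpa using h k le_rfl
  | succ j ih =>
    have hC : 0 ≤ C := (abs_nonneg _).trans (h k le_rfl)
    cases k with
    | zero =>
      rw [pow_succ', Module.End.mul_apply, bdiff_zero]
      refine (ih h).trans ?_
      rw [pow_succ]; nlinarith [pow_pos (two_pos : (0:ℝ) < 2) j]
    | succ k =>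
      rw [bdiff_pow_succ_apply]
      have h1 := ih h
      have h2 := ih (k := k) fun i hi => h i (by omega)
      refine (abs_sub _ _).trans ?_
      rw [pow_succ]; linarith

lemma bdiff_pow_eq_zero {f : ℕ → ℝ} {m : ℕ} {c : ℝ} (h : ∀ k, m ≤ k → f k = c) {j : ℕ}
    (hj : j ≠ 0) {k : ℕ} (hk : m + j ≤ k) : (bdiff ^ j) f k = 0 := by
  induction j generalizing k with
  | zero => exact absurd rfl hj
  | succ j ih =>
    obtain ⟨k, rfl⟩ : ∃ k', k = k' + 1 := ⟨k - 1, by omega⟩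
    rw [bdiff_pow_succ_apply]
    rcases Nat.eq_zero_or_pos j with rfl | hj'
    · simp [h k (by omega), h (k + 1) (by omega)]
    · rw [ih hj'.ne' (by omega), ih hj'.ne' (by omega), sub_zero]

lemma bdiff_pow_at_zero (f : ℕ → ℝ) (n : ℕ) : (bdiff ^ n) f 0 = f 0 := by
  induction n with
  | zero => simp
  | succ n ih => rw [pow_succ', Module.End.mul_apply, bdiff_zero, ih]

/-- If the values of `f` at `k` and `m - k` add up to a constant, then differences of order `j ≥ 1`
of `f` change by the sign `(-1)^(j+1)` under the reflection `k ↦ m + j - k`. -/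
lemma bdiff_pow_reflect {f : ℕ → ℝ} {m : ℕ} {c : ℝ} (h : ∀ k ≤ m, f k + f (m - k) = c)
    (h0 : f 0 = 0) (hc : ∀ k, m ≤ k → f k = c) {j k : ℕ} (hj : j ≠ 0) (hk : k ≤ m + j) :
    (bdiff ^ j) f (m + j - k) = -(-1) ^ j * (bdiff ^ j) f k := by
  induction j generalizing k with
  | zero => exact absurd rfl hj
  | succ j ih =>
    rcases Nat.eq_zero_or_pos k with rfl | hk0
    · rw [Nat.sub_zero, bdiff_pow_eq_zero hc hj le_rfl, bdiff_pow_at_zero, h0, mul_zero]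
    rcases hk.eq_or_lt with rfl | hk
    · rw [Nat.sub_self, bdiff_pow_eq_zero hc hj le_rfl, bdiff_pow_at_zero, h0, mul_zero]
    obtain ⟨k, rfl⟩ : ∃ k', k = k' + 1 := ⟨k - 1, by omega⟩
    rw [show m + (j + 1) - (k + 1) = (m + j - (k + 1)) + 1 by omega, bdiff_pow_succ_apply,
      bdiff_pow_succ_apply, show m + j - (k + 1) + 1 = m + j - k by omega]
    rcases Nat.eq_zero_or_pos j with rfl | hj'
    · have h1 := h k (by omega)
      have h2 := h (k + 1) (by omega)
      simp only [add_zero, pow_zero, Module.End.one_apply]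
      rw [zero_add, pow_one]
      linarith
    · rw [ih hj'.ne' (by omega), ih hj'.ne' (by omega), pow_succ]
      ring

/-! ### The distribution function of the number of descents -/

/-- `cumEuler n a` is the `n`-th backward difference of `k ↦ k ^ n` at `a`; it turns out to be the
number of permutations of `n ≥ 1` letters with fewer than `a` descents. -/
noncomputable def cumEuler (n : ℕ) : ℕ → ℝ := (bdiff ^ n) fun k => (k : ℝ) ^ n

lemma cumEuler_zero_left (a : ℕ) : cumEuler 0 a = 1 := by simp [cumEuler]

lemma cumEuler_succ_zero (n : ℕ) : cumEuler (n + 1) 0 = 0 := by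
  simp [cumEuler, bdiff_pow_at_zero]

lemma bdiff_pow_monomial {n j : ℕ} (hj : j ≤ n) :
    (bdiff ^ n) (fun k : ℕ => (k : ℝ) ^ (n - j)) = (bdiff ^ j) (cumEuler (n - j)) := by
  unfold cumEuler
  rw [← Module.End.mul_apply, ← pow_add, Nat.add_sub_cancel' hj]

/-- The recurrence of the Eulerian numbers, summed over the number of descents. -/
lemma cumEuler_succ_succ (n a : ℕ) :
    cumEuler (n + 1) (a + 1) =
      ((a : ℝ) + 1) * cumEuler n (a + 1) + ((n : ℝ) - a) * cumEuler n a := by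
  have h : (fun k : ℕ => (k : ℝ) ^ (n + 1)) = mulIndex fun k : ℕ => (k : ℝ) ^ n := by
    ext k; simp [pow_succ']
  have h2 : cumEuler (n + 1) = (bdiff ^ (n + 1) * mulIndex) fun k : ℕ => (k : ℝ) ^ n := by
    rw [cumEuler, h, Module.End.mul_apply]
  rw [h2, bdiff_pow_mul_mulIndex]
  simp only [LinearMap.add_apply, LinearMap.smul_apply, Module.End.mul_apply, Pi.add_apply,
    Pi.smul_apply, mulIndex_apply, seqShift_succ, bdiff_pow_succ_apply, smul_eq_mul]
  unfold cumEuler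
  push_cast
  ring

lemma cumEuler_of_le {n a : ℕ} (h : n ≤ a) : cumEuler n a = n.factorial := by
  induction n generalizing a with
  | zero => simp [cumEuler_zero_left]
  | succ n ih =>
    obtain ⟨a, rfl⟩ : ∃ a', a = a' + 1 := ⟨a - 1, by omega⟩
    rw [cumEuler_succ_succ, ih (by omega), ih (by omega), Nat.factorial_succ]
    push_cast
    ring

/-- The symmetry of the distribution of the number of descents about its mean. -/
lemma cumEuler_reflect {m a : ℕ} (hm : m ≠ 0) (h : a ≤ m) :
    cumEuler m a + cumEuler m (m - a) = m.factorial := by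
  induction m generalizing a with
  | zero => exact absurd rfl hm
  | succ m ih =>
    rcases Nat.eq_zero_or_pos a with rfl | ha
    · rw [cumEuler_succ_zero, zero_add]; exact cumEuler_of_le (by omega)
    rcases h.eq_or_lt with rfl | h
    · rw [cumEuler_of_le le_rfl, Nat.sub_self, cumEuler_succ_zero, add_zero]
    obtain ⟨a, rfl⟩ : ∃ a', a = a' + 1 := ⟨a - 1, by omega⟩
    obtain ⟨b, rfl⟩ : ∃ b, m = a + b + 1 := ⟨m - a - 1, by omega⟩
    have h1 := ih (a := a) (by omega) (by omega)
    have h2 := ih (a := a + 1) (by omega) (by omega)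
    rw [show a + b + 1 - a = b + 1 by omega] at h1
    rw [show a + b + 1 - (a + 1) = b by omega] at h2
    rw [show a + b + 1 + 1 - (a + 1) = b + 1 by omega, cumEuler_succ_succ _ a, cumEuler_succ_succ _ b,
      Nat.factorial_succ]
    push_cast at *
    linear_combination ((a : ℝ) + 1) * h2 + ((b : ℝ) + 1) * h1

lemma cumEuler_nonneg (n a : ℕ) : 0 ≤ cumEuler n a := by
  induction n generalizing a with
  | zero => simp [cumEuler_zero_left]
  | succ n ih =>
    rcases le_or_gt (n + 1) a with h | h
    · rw [cumEuler_of_le h]; positivity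
    cases a with
    | zero => rw [cumEuler_succ_zero]
    | succ a =>
      rw [cumEuler_succ_succ]
      have : (a : ℝ) ≤ n := by exact_mod_cast (by omega : a ≤ n)
      have h1 := ih a
      have h2 := ih (a + 1)
      have : 0 ≤ (n : ℝ) - a := by linarith
      positivity

lemma cumEuler_pos (n a : ℕ) : 0 < cumEuler n (a + 1) := by
  induction n with
  | zero => simp [cumEuler_zero_left]
  | succ n ih =>
    rcases le_or_gt (n + 1) (a + 1) with h | h
    · rw [cumEuler_of_le h]; positivity
    rw [cumEuler_succ_succ]
    have : (a : ℝ) ≤ n := by exact_mod_cast (by omega : a ≤ n)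
    have h1 := cumEuler_nonneg n a
    have : 0 ≤ (n : ℝ) - a := by linarith
    positivity

lemma cumEuler_mono_succ (n a : ℕ) : cumEuler n a ≤ cumEuler n (a + 1) := by
  induction n generalizing a with
  | zero => simp [cumEuler_zero_left]
  | succ n ih =>
    rcases le_or_gt (n + 1) a with h | h
    · rw [cumEuler_of_le h, cumEuler_of_le (by omega)]
    cases a with
    | zero => rw [cumEuler_succ_zero]; exact cumEuler_nonneg _ _
    | succ a =>
      rw [cumEuler_succ_succ, cumEuler_succ_succ]
      have : (a : ℝ) + 1 ≤ n := by exact_mod_cast (by omega : a + 1 ≤ n)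
      have h1 := ih a
      have h2 := ih (a + 1)
      push_cast
      nlinarith

lemma cumEuler_mono (n : ℕ) : Monotone (cumEuler n) := monotone_nat_of_le_succ (cumEuler_mono_succ n)

/-- The numbers of permutations with fewer than `a` descents form a log-concave sequence in `a`. -/
lemma cumEuler_logConcave (n a : ℕ) :
    cumEuler n a * cumEuler n (a + 2) ≤ cumEuler n (a + 1) ^ 2 := by
  induction n generalizing a with
  | zero => simp [cumEuler_zero_left]
  | succ n ih =>
    rcases le_or_gt (n + 1) (a + 1) with h | h
    · rw [cumEuler_of_le h, cumEuler_of_le (a := a + 2) (by omega), sq]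
      gcongr
      rw [← cumEuler_of_le h]
      exact cumEuler_mono_succ _ _
    cases a with
    | zero =>
      rw [cumEuler_succ_zero, zero_mul]; positivity
    | succ a =>
      have hn : (a : ℝ) + 2 ≤ n := by exact_mod_cast (by omega : a + 2 ≤ n)
      have e1 := cumEuler_succ_succ n a
      have e2 := cumEuler_succ_succ n (a + 1)
      have e3 := cumEuler_succ_succ n (a + 2)
      push_cast at e1 e2 e3
      rw [show a + 1 + 2 = a + 2 + 1 by omega, show a + 1 + 1 = a + 2 by omega] at *
      rw [e1, e2, e3]
      have i1 := ih a
      have i2 := ih (a + 1)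
      rw [show a + 1 + 2 = a + 2 + 1 by omega, show a + 1 + 1 = a + 2 by omega] at *
      have p0 := cumEuler_nonneg n a
      have p1 := cumEuler_pos n a
      have p2 := cumEuler_pos n (a + 1)
      have p3 := cumEuler_pos n (a + 2)
      rw [show a + 1 + 1 = a + 2 by omega] at *
      set h0 := cumEuler n a
      set h1 := cumEuler n (a + 1)
      set h2 := cumEuler n (a + 2)
      set h3 := cumEuler n (a + 2 + 1)
      have i3 : h0 * h3 ≤ h1 * h2 := by
        have := mul_le_mul i1 i2 (by positivity) (by positivity)
        refine le_of_mul_le_mul_right (a := h1 * h2) ?_ (by positivity)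
        nlinarith
      -- with `b = n - a - 2`, the defect is at least `(h2 - h1) ^ 2`
      obtain ⟨b, hb, hb'⟩ : ∃ b : ℝ, (n : ℝ) = a + 2 + b ∧ 0 ≤ b := ⟨n - a - 2, by ring, by linarith⟩
      have ha : (0 : ℝ) ≤ a := by positivity
      rw [hb]
      nlinarith [sq_nonneg (h2 - h1), mul_le_mul_of_nonneg_left i3 (by positivity : 0 ≤ (a + 3) * (b + 2)),
        mul_le_mul_of_nonneg_left i2 (by positivity : 0 ≤ ((a : ℝ) + 1) * (a + 3)),
        mul_le_mul_of_nonneg_left i1 (by positivity : 0 ≤ b * (b + 2))]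

/-! ### Words compatible with a permutation -/

open scoped Classical in
/-- The words `u` of length `n` with letters in `{0, …, k-1}` such that
`u (i + 1) ≥ u i + d i` for all positions `i`. -/
noncomputable def gapWords (d : ℕ → ℕ) (n k : ℕ) : Finset (Fin n → ℕ) :=
  (Fintype.piFinset fun _ => Finset.range k).filter fun u =>
    ∀ i : ℕ, ∀ h : i + 1 < n, u ⟨i, by omega⟩ + d i ≤ u ⟨i + 1, h⟩

lemma mem_gapWords {d : ℕ → ℕ} {n k : ℕ} {u : Fin n → ℕ} :
    u ∈ gapWords d n k ↔ (∀ i, u i < k) ∧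
      ∀ i : ℕ, ∀ h : i + 1 < n, u ⟨i, by omega⟩ + d i ≤ u ⟨i + 1, h⟩ := by
  simp [gapWords]

lemma monotone_of_mem_gapWords {d : ℕ → ℕ} {n k : ℕ} {u : Fin n → ℕ} (h : u ∈ gapWords d n k) :
    Monotone u := by
  rw [mem_gapWords] at h
  cases n with
  | zero => exact fun i => i.elim0
  | succ n =>
    rw [Fin.monotone_iff_le_succ]
    intro i
    have := h.2 i (by omega)
    exact (Nat.le_add_right _ _).trans this

lemma card_gapWords_zero (d : ℕ → ℕ) (k : ℕ) : (gapWords d 0 k).card = 1 := by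
  rw [Finset.card_eq_one]
  refine ⟨Fin.elim0, ?_⟩
  ext u
  simp [mem_gapWords, Subsingleton.elim u Fin.elim0]

lemma card_gapWords_letters_zero (d : ℕ → ℕ) (n : ℕ) : (gapWords d (n + 1) 0).card = 0 := by
  rw [Finset.card_eq_zero, Finset.eq_empty_iff_forall_notMem]
  intro u hu
  simpa using (mem_gapWords.1 hu).1 0

lemma card_gapWords_one (d : ℕ → ℕ) (k : ℕ) : (gapWords d 1 k).card = k := by
  have : (gapWords d 1 k).card = (Finset.range k).card := by
    refine Finset.card_nbij' (fun u => u 0) (fun m _ => m) ?_ ?_ ?_ ?_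
    · intro u hu
      simpa using (mem_gapWords.1 hu).1 0
    · intro m hm
      exact mem_gapWords.2 ⟨fun _ => by simpa using hm, fun i h => by omega⟩
    · intro u hu
      ext i
      rw [Subsingleton.elim i 0]
    · intro m hm
      rfl
  rw [this, Finset.card_range]

/-- Words are classified by whether their last letter is the largest admissible letter `k`. -/
lemma card_gapWords_succ (d : ℕ → ℕ) (n k : ℕ) :
    (gapWords d (n + 2) (k + 1)).card =
      (gapWords d (n + 2) k).card + (gapWords d (n + 1) (k + 1 - d n)).card := by
  classical
  rw [← Finset.card_filter_add_card_filter_not (s := gapWords d (n + 2) (k + 1))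
    (fun u => u (Fin.last (n + 1)) < k)]
  congr 1
  · congr 1
    ext u
    rw [Finset.mem_filter]
    constructor
    · rintro ⟨hu, hk⟩
      exact mem_gapWords.2 ⟨fun i => (monotone_of_mem_gapWords hu (Fin.le_last i)).trans_lt hk,
        (mem_gapWords.1 hu).2⟩
    · intro hu
      have hu' := mem_gapWords.1 hu
      exact ⟨mem_gapWords.2 ⟨fun i => (hu'.1 i).trans (Nat.lt_succ_self k), hu'.2⟩, hu'.1 _⟩
  · refine Finset.card_nbij' (fun u => Fin.init u)
      (fun u => Fin.snoc (α := fun _ => ℕ) u k) ?_ ?_ ?_ ?_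
    · intro u hu
      simp only [Finset.coe_filter, Set.mem_ofPred_eq, not_lt] at hu
      have hu' := mem_gapWords.1 hu.1
      have hlast := hu'.1 (Fin.last (n + 1))
      have hmono := monotone_of_mem_gapWords hu.1
      have h2 : u ⟨n, by omega⟩ + d n ≤ u (Fin.last (n + 1)) := hu'.2 n (by omega)
      refine mem_gapWords.2 ⟨fun i => ?_, fun i h => hu'.2 i (by omega)⟩
      have : u i.castSucc ≤ u ⟨n, by omega⟩ := hmono (Fin.le_def.2 (Nat.lt_succ_iff.1 i.2))
      change u i.castSucc < _
      omega
    · intro u hu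
      have hu' := mem_gapWords.1 hu
      simp only [Finset.coe_filter, Set.mem_ofPred_eq, Fin.snoc_last, lt_irrefl, not_false_eq_true,
        and_true]
      refine mem_gapWords.2 ⟨fun i => ?_, fun i h => ?_⟩
      · refine Fin.lastCases ?_ (fun i => ?_) i
        · simp
        · have := hu'.1 i
          rw [Fin.snoc_castSucc]
          omega
      · rcases Nat.lt_or_ge (i + 1) (n + 1) with h1 | h1
        · have e1 : (⟨i, by omega⟩ : Fin (n + 2)) = Fin.castSucc ⟨i, by omega⟩ := rfl
          have e2 : (⟨i + 1, h⟩ : Fin (n + 2)) = Fin.castSucc ⟨i + 1, h1⟩ := rfl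
          rw [e1, e2, Fin.snoc_castSucc, Fin.snoc_castSucc]
          exact hu'.2 i h1
        · obtain rfl : i = n := by omega
          have e1 : (⟨i, by omega⟩ : Fin (i + 2)) = Fin.castSucc ⟨i, by omega⟩ := rfl
          have e2 : (⟨i + 1, h⟩ : Fin (i + 2)) = Fin.last _ := rfl
          rw [e1, e2, Fin.snoc_castSucc, Fin.snoc_last]
          have := hu'.1 ⟨i, by omega⟩
          omega
    · intro u hu
      simp only [Finset.coe_filter, Set.mem_ofPred_eq, not_lt] at hu
      have hlast := (mem_gapWords.1 hu.1).1 (Fin.last (n + 1))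
      have : k = u (Fin.last (n + 1)) := by omega
      conv_lhs => rw [this]
      exact Fin.snoc_init_self u
    · intro u hu
      exact Fin.init_snoc _ _

lemma card_gapWords_zero_gap (n k : ℕ) : (gapWords 0 n k).card = k.multichoose n := by
  induction n generalizing k with
  | zero => rw [card_gapWords_zero, Nat.multichoose_zero_right]
  | succ n ihn =>
    cases n with
    | zero => rw [card_gapWords_one, Nat.multichoose_one_right]
    | succ n =>
      induction k with
      | zero => rw [card_gapWords_letters_zero, Nat.multichoose_zero_succ]
      | succ k ihk =>
        rw [card_gapWords_succ, ihk, Nat.multichoose_succ_succ, Pi.zero_apply, Nat.sub_zero, ihn,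
          add_comm]

lemma seqShift_pow_one_apply (m k : ℕ) :
    (seqShift ^ m) (fun _ => 1) k = if m ≤ k then 1 else 0 := by
  induction m generalizing k with
  | zero => simp
  | succ m ih =>
    rw [pow_succ', Module.End.mul_apply]
    cases k with
    | zero => simp
    | succ k => rw [seqShift_succ, ih]; simp

lemma bdiff_pow_card_gapWords {d : ℕ → ℕ} (hd : ∀ i, d i ≤ 1) (n : ℕ) :
    (bdiff ^ (n + 1)) (fun k => ((gapWords d (n + 1) k).card : ℝ)) =
      (seqShift ^ (∑ i ∈ Finset.range n, d i + 1)) fun _ => 1 := by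
  induction n with
  | zero =>
    ext k
    cases k with
    | zero => simp [card_gapWords_letters_zero]
    | succ k => simp [card_gapWords_one]
  | succ n ih =>
    have key : bdiff (fun k => ((gapWords d (n + 2) k).card : ℝ)) =
        (seqShift ^ d n) fun k => ((gapWords d (n + 1) k).card : ℝ) := by
      ext k
      rcases Nat.le_one_iff_eq_zero_or_eq_one.1 (hd n) with h | h
      · cases k with
        | zero => simp [card_gapWords_letters_zero, h]
        | succ k => simp [card_gapWords_succ, h]
      · cases k with
        | zero => simp [card_gapWords_letters_zero, h]
        | succ k => simp [card_gapWords_succ, h]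
    rw [pow_succ, Module.End.mul_apply, key, ← Module.End.mul_apply,
      (bdiff_commute_seqShift.pow_pow (n + 1) (d n)).eq, Module.End.mul_apply, ih,
      ← Module.End.mul_apply, ← pow_add, Finset.sum_range_succ]
    congr 2
    ring

/-- The indicator of the descent positions of `σ`. -/
def desInd {n : ℕ} (σ : Equiv.Perm (Fin n)) (i : ℕ) : ℕ :=
  if ∃ h : i + 1 < n, σ ⟨i + 1, h⟩ < σ ⟨i, Nat.lt_of_succ_lt h⟩ then 1 else 0

lemma desInd_le_one {n : ℕ} (σ : Equiv.Perm (Fin n)) (i : ℕ) : desInd σ i ≤ 1 := by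
  unfold desInd; split_ifs <;> simp

lemma sum_desInd {n : ℕ} (σ : Equiv.Perm (Fin (n + 1))) :
    ∑ i ∈ Finset.range n, desInd σ i = descents σ := by
  have h : ∑ i ∈ Finset.range (n + 1), desInd σ i = ∑ i ∈ Finset.range n, desInd σ i := by
    rw [Finset.sum_range_succ, add_eq_left]
    simp [desInd]
  rw [← h, ← Fin.sum_univ_eq_sum_range, descents, Finset.card_filter]
  rfl

/-- The number of words in `k` letters compatible with `σ`, as a function of `k`, is an `n`-fold
sum of the indicator of `k > descents σ`. -/
lemma bdiff_pow_card_gapWords_desInd {n : ℕ} (hn : n ≠ 0) (σ : Equiv.Perm (Fin n)) (a : ℕ) :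
    (bdiff ^ n) (fun k => ((gapWords (desInd σ) n k).card : ℝ)) a =
      if descents σ < a then 1 else 0 := by
  obtain ⟨n, rfl⟩ : ∃ m, n = m + 1 := ⟨n - 1, by omega⟩
  rw [bdiff_pow_card_gapWords (desInd_le_one σ), seqShift_pow_one_apply,
    sum_desInd]
  rfl

/-- A word `u` is compatible with `σ`, that is, increases strictly at the descents of `σ`, if and
only if the pairs `(u i, σ i)` increase strictly in the lexicographic order. -/
lemma mem_gapWords_desInd {n k : ℕ} {σ : Equiv.Perm (Fin n)} {u : Fin n → ℕ} :
    u ∈ gapWords (desInd σ) n k ↔ (∀ i, u i < k) ∧ StrictMono fun i => toLex (u i, σ i) := by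
  rw [mem_gapWords, and_congr_right_iff]
  intro _
  cases n with
  | zero => exact ⟨fun _ i => i.elim0, fun _ i h => by omega⟩
  | succ n =>
    rw [Fin.strictMono_iff_lt_succ]
    have key : ∀ i : Fin n, toLex (u i.castSucc, σ i.castSucc) < toLex (u i.succ, σ i.succ) ↔
        u i.castSucc + desInd σ i ≤ u i.succ := by
      intro i
      have hne : σ i.castSucc ≠ σ i.succ := fun h => by
        have := σ.injective h
        exact (Fin.castSucc_lt_succ (i := i)).ne this
      have hd : desInd σ i = if σ i.succ < σ i.castSucc then 1 else 0 := by
        unfold desInd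
        refine if_congr ⟨fun ⟨h, h'⟩ => h', fun h => ⟨by omega, h⟩⟩ rfl rfl
      rw [Prod.Lex.toLex_lt_toLex, hd]
      split_ifs with h
      · have := h.not_gt
        simp only [this, and_false, or_false]
        omega
      · have := lt_of_le_of_ne (not_lt.1 h) hne
        simp only [this, and_true]
        omega
    exact ⟨fun h i => (key i).2 (h i (by omega)),
      fun h i hi => (key ⟨i, by omega⟩).1 (h ⟨i, by omega⟩)⟩

lemma mem_gapWords_zero_gap {n k : ℕ} {u : Fin n → ℕ} :
    u ∈ gapWords 0 n k ↔ (∀ i, u i < k) ∧ Monotone u := by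
  refine ⟨fun h => ⟨(mem_gapWords.1 h).1, monotone_of_mem_gapWords h⟩,
    fun h => mem_gapWords.2 ⟨h.1, fun i hi => h.2 (Fin.le_def.2 (Nat.le_succ i))⟩⟩

/-- A weakly increasing word `p` in `k * l` letters is coded by `u = p / l` and `v = p % l`;
stably sorting `v` yields a permutation `σ⁻¹`, such that `u` is compatible with `σ` and
`v ∘ σ⁻¹` with `σ⁻¹`. This is a bijection. -/
lemma sum_card_gapWords_mul (n k l : ℕ) :
    ∑ σ : Equiv.Perm (Fin n), (gapWords (desInd σ) n k).card * (gapWords (desInd σ⁻¹) n l).card =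
      (gapWords 0 n (k * l)).card := by
  simp_rw [← Finset.card_product]
  rw [← Finset.card_sigma]
  have hmod : ∀ {a b : ℕ}, b < l → (a * l + b) % l = b := fun {a b} h => by
    rw [add_comm, Nat.add_mul_mod_self_right, Nat.mod_eq_of_lt h]
  have hinv : ∀ (s : Equiv.Perm (Fin n)) (i : Fin n), s (s⁻¹ i) = i := fun s i =>
    s.apply_symm_apply i
  have hdiv : ∀ {a b : ℕ}, b < l → (a * l + b) / l = a := fun {a b} h => by
    rw [add_comm, Nat.add_mul_div_right _ _ (by omega), Nat.div_eq_of_lt h, zero_add]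
  refine Finset.card_nbij'
    (fun x i => x.2.1 i * l + x.2.2 (x.1 i))
    (fun p => ⟨(Tuple.sort fun i => p i % l)⁻¹, fun i => p i / l,
      fun i => p (Tuple.sort (fun i => p i % l) i) % l⟩) ?_ ?_ ?_ ?_
  · rintro ⟨σ, u, w⟩ hx
    simp only [Finset.coe_sigma, Set.mem_sigma_iff, Finset.coe_univ, Set.mem_univ, true_and,
      SetLike.mem_coe, Finset.mem_product, mem_gapWords_desInd] at hx
    obtain ⟨⟨hu, hu'⟩, hw, hw'⟩ := hx
    refine mem_gapWords_zero_gap.2 ⟨fun i => ?_, fun i j hij => ?_⟩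
    · have h1 := hu i
      have h2 := hw (σ i)
      calc u i * l + w (σ i) < (u i + 1) * l := by rw [add_mul]; omega
        _ ≤ k * l := Nat.mul_le_mul_right _ h1
    · rcases hij.eq_or_lt with rfl | hij
      · exact le_rfl
      rcases Prod.Lex.toLex_lt_toLex.1 (hu' hij) with h | ⟨h, h'⟩
      · have h2 := hw (σ i)
        calc u i * l + w (σ i) ≤ (u i + 1) * l := by rw [add_mul]; omega
          _ ≤ u j * l := Nat.mul_le_mul_right _ h
          _ ≤ _ := Nat.le_add_right _ _
      · simp only at h h' ⊢
        rw [h]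
        have : w (σ i) ≤ w (σ j) := by
          rcases Prod.Lex.toLex_lt_toLex.1 (hw' h') with h | ⟨h, -⟩
          · exact h.le
          · exact h.le
        omega
  · intro p hp
    obtain ⟨hp, hp'⟩ := mem_gapWords_zero_gap.1 hp
    have hs := Tuple.eq_sort_iff.1 (rfl : Tuple.sort (fun i => p i % l) = _)
    set s := Tuple.sort fun i => p i % l
    have hl : ∀ i : Fin n, 0 < l := fun i => Nat.pos_of_ne_zero fun h => by
      have := hp i; simp [h] at this
    have hlex : StrictMono fun i => toLex (p (s i) % l, s i) := by
      intro i j hij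
      rw [Prod.Lex.toLex_lt_toLex]
      rcases (hs.1 hij.le).eq_or_lt with h | h
      · exact Or.inr ⟨h, hs.2 i j hij h⟩
      · exact Or.inl h
    simp only [Finset.coe_sigma, Set.mem_sigma_iff, Finset.coe_univ, Set.mem_univ, true_and,
      SetLike.mem_coe, Finset.mem_product, mem_gapWords_desInd, inv_inv]
    refine ⟨⟨fun i => Nat.div_lt_of_lt_mul (by rw [mul_comm]; exact hp i), fun i j hij => ?_⟩,
      fun i => Nat.mod_lt _ (hl i), hlex⟩
    rw [Prod.Lex.toLex_lt_toLex]
    have hle := hp' hij.le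
    rcases (Nat.div_le_div_right (c := l) hle).eq_or_lt with h | h
    · refine Or.inr ⟨h, ?_⟩
      by_contra hcon
      have hne : s⁻¹ i ≠ s⁻¹ j := fun h => hij.ne ((s⁻¹).injective h)
      have hlt := hlex (lt_of_le_of_ne (not_lt.1 hcon) hne.symm)
      change toLex (p (s (s⁻¹ j)) % l, s (s⁻¹ j)) < toLex (p (s (s⁻¹ i)) % l, s (s⁻¹ i)) at hlt
      rw [hinv, hinv] at hlt
      have e1 := Nat.div_add_mod (p i) l
      have e2 := Nat.div_add_mod (p j) l
      rcases Prod.Lex.toLex_lt_toLex.1 hlt with h1 | ⟨-, h1⟩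
      · simp only at h1 h
        rw [h] at e1
        omega
      · exact absurd h1 hij.not_gt
    · exact Or.inl h
  · rintro ⟨σ, u, w⟩ hx
    simp only [Finset.coe_sigma, Set.mem_sigma_iff, Finset.coe_univ, Set.mem_univ, true_and,
      SetLike.mem_coe, Finset.mem_product, mem_gapWords_desInd] at hx
    obtain ⟨⟨hu, hu'⟩, hw, hw'⟩ := hx
    have hv : (fun i => (u i * l + w (σ i)) % l) = fun i => w (σ i) := by
      ext i; exact hmod (hw _)
    have hsort : Tuple.sort (fun i => w (σ i)) = σ⁻¹ := by
      symm
      rw [Tuple.eq_sort_iff]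
      constructor
      · intro i j hij
        simp only [Function.comp, hinv]
        rcases hij.eq_or_lt with rfl | hij
        · exact le_rfl
        · rcases Prod.Lex.toLex_lt_toLex.1 (hw' hij) with h | ⟨h, -⟩ <;> exact h.le
      · intro i j hij h
        simp only [hinv] at h
        rcases Prod.Lex.toLex_lt_toLex.1 (hw' hij) with h1 | ⟨-, h1⟩
        · exact absurd h h1.ne
        · exact h1
    simp only [hv, hsort, inv_inv]
    congr 1
    refine Prod.ext ?_ ?_
    · ext i; exact hdiv (hw _)
    · ext i; simp [Nat.mod_eq_of_lt (hw i)]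
  · intro p hp
    ext i
    simp only [hinv]
    rw [mul_comm]
    exact Nat.div_add_mod _ _

/-! ### The joint distribution of descents -/

/-- The `j`-th elementary symmetric polynomial of `0, 1, …, n - 1`, that is, the unsigned Stirling
number of the first kind `c(n, n - j)`. -/
def esymmRange : ℕ → ℕ → ℕ
  | _, 0 => 1
  | 0, _ + 1 => 0
  | n + 1, j + 1 => esymmRange n (j + 1) + n * esymmRange n j

@[simp] lemma esymmRange_zero_right (n : ℕ) : esymmRange n 0 = 1 := by cases n <;> rfl
@[simp] lemma esymmRange_zero_succ (j : ℕ) : esymmRange 0 (j + 1) = 0 := rfl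
lemma esymmRange_succ_succ (n j : ℕ) :
    esymmRange (n + 1) (j + 1) = esymmRange n (j + 1) + n * esymmRange n j := rfl

lemma esymmRange_eq_zero {n j : ℕ} (h : n < j) : esymmRange n j = 0 := by
  induction n generalizing j with
  | zero => obtain ⟨j, rfl⟩ : ∃ j', j = j' + 1 := ⟨j - 1, by omega⟩; simp
  | succ n ih =>
    obtain ⟨j, rfl⟩ : ∃ j', j = j' + 1 := ⟨j - 1, by omega⟩
    rw [esymmRange_succ_succ, ih (by omega), ih (by omega)]; simp

lemma esymmRange_self {n : ℕ} (hn : n ≠ 0) : esymmRange n n = 0 := by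
  induction n with
  | zero => exact absurd rfl hn
  | succ n ih =>
    rw [esymmRange_succ_succ, esymmRange_eq_zero (Nat.lt_succ_self n), zero_add]
    rcases Nat.eq_zero_or_pos n with rfl | h
    · simp
    · simp [ih h.ne']

lemma ascFactorial_eq_sum_esymmRange (N n : ℕ) :
    N.ascFactorial n = ∑ j ∈ Finset.range (n + 1), esymmRange n j * N ^ (n - j) := by
  induction n with
  | zero => simp
  | succ n ih =>
    rw [Nat.ascFactorial_succ, ih, Finset.sum_range_succ' _ (n + 1)]
    simp only [esymmRange_succ_succ, add_mul, Finset.sum_add_distrib, Nat.add_sub_add_right,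
      esymmRange_zero_right, Nat.sub_zero, one_mul]
    have h1 : N * ∑ j ∈ Finset.range (n + 1), esymmRange n j * N ^ (n - j) =
        ∑ j ∈ Finset.range (n + 1), esymmRange n (j + 1) * N ^ (n - j) + N ^ (n + 1) := by
      rw [Finset.sum_range_succ (fun j => esymmRange n (j + 1) * N ^ (n - j)),
        esymmRange_eq_zero (Nat.lt_succ_self n), zero_mul, add_zero, Finset.mul_sum,
        Finset.sum_range_succ']
      simp only [esymmRange_zero_right, one_mul, Nat.sub_zero]
      congr 1
      · refine Finset.sum_congr rfl fun j hj => ?_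
        rw [Finset.mem_range] at hj
        rw [show n - j = n - (j + 1) + 1 by omega, pow_succ]
        ring
      · ring
    rw [h1, Finset.mul_sum]
    simp only [mul_assoc]
    ring

/-- An identity between sums of products `f(k) g(l)` is preserved if a linear operator is applied in
both variables. -/
lemma sum_map_mul_map {ι κ : Type*} {s : Finset ι} {t : Finset κ} {f g : ι → ℕ → ℝ}
    {F G : κ → ℕ → ℝ}
    (h : ∀ k l, ∑ i ∈ s, f i k * g i l = ∑ j ∈ t, F j k * G j l)
    (D : Module.End ℝ (ℕ → ℝ)) (a b : ℕ) :
    ∑ i ∈ s, D (f i) a * D (g i) b = ∑ j ∈ t, D (F j) a * D (G j) b := by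
  have h1 : ∀ l, ∑ i ∈ s, D (f i) a * g i l = ∑ j ∈ t, D (F j) a * G j l := by
    intro l
    have : ∑ i ∈ s, g i l • f i = ∑ j ∈ t, G j l • F j := by
      ext k
      simp only [Finset.sum_apply, Pi.smul_apply, smul_eq_mul]
      simpa only [mul_comm] using h k l
    have := congrFun (congrArg D this) a
    simpa only [map_sum, map_smul, Finset.sum_apply, Pi.smul_apply, smul_eq_mul, mul_comm] using this
  have : ∑ i ∈ s, D (f i) a • g i = ∑ j ∈ t, D (F j) a • G j := by
    ext l
    simpa only [Finset.sum_apply, Pi.smul_apply, smul_eq_mul] using h1 l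
  have := congrFun (congrArg D this) b
  simpa only [map_sum, map_smul, Finset.sum_apply, Pi.smul_apply, smul_eq_mul] using this

/-- Applying `∇^n` in both variables to the count of compatible pairs of words. -/
lemma factorial_mul_card_descents_lt {n : ℕ} (hn : n ≠ 0) (a b : ℕ) :
    (n.factorial : ℝ) *
      ((Finset.univ.filter fun σ : Equiv.Perm (Fin n) =>
        descents σ < a ∧ descents σ⁻¹ < b).card : ℝ) =
      ∑ j ∈ Finset.range (n + 1), (esymmRange n j : ℝ) *
        ((bdiff ^ j) (cumEuler (n - j)) a * (bdiff ^ j) (cumEuler (n - j)) b) := by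
  have h : ∀ k l : ℕ, ∑ σ : Equiv.Perm (Fin n),
      ((n.factorial : ℝ) • fun k => ((gapWords (desInd σ) n k).card : ℝ)) k *
        (fun l => ((gapWords (desInd σ⁻¹) n l).card : ℝ)) l =
      ∑ j ∈ Finset.range (n + 1), ((esymmRange n j : ℝ) • fun k : ℕ => (k : ℝ) ^ (n - j)) k *
        (fun l : ℕ => (l : ℝ) ^ (n - j)) l := by
    intro k l
    have h1 := sum_card_gapWords_mul n k l
    have h2 := Nat.ascFactorial_eq_factorial_mul_choose' (k * l) n
    rw [← Nat.multichoose_eq, ← card_gapWords_zero_gap, ← h1, ascFactorial_eq_sum_esymmRange] at h2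
    have h3 := congrArg (Nat.cast : ℕ → ℝ) h2
    push_cast at h3
    simp only [Pi.smul_apply, smul_eq_mul]
    rw [Finset.mul_sum] at h3
    simp only [mul_assoc]
    rw [← h3]
    refine Finset.sum_congr rfl fun j _ => ?_
    rw [mul_pow]
  have h2 := sum_map_mul_map h (bdiff ^ n) a b
  simp only [map_smul, Pi.smul_apply, smul_eq_mul, bdiff_pow_card_gapWords_desInd hn] at h2
  rw [Finset.card_filter]
  push_cast
  rw [Finset.mul_sum]
  convert h2 using 1
  · refine Finset.sum_congr rfl fun σ _ => ?_
    by_cases h1 : descents σ < a <;> by_cases h2 : descents σ⁻¹ < b <;> simp [h1, h2]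
  · refine Finset.sum_congr rfl fun j hj => ?_
    rw [Finset.mem_range] at hj
    rw [bdiff_pow_monomial (by omega), mul_assoc]

lemma descents_lt {n : ℕ} (hn : n ≠ 0) (σ : Equiv.Perm (Fin n)) : descents σ < n := by
  obtain ⟨n, rfl⟩ := Nat.exists_eq_succ_of_ne_zero hn
  rw [← sum_desInd]
  calc ∑ i ∈ Finset.range n, desInd σ i ≤ ∑ i ∈ Finset.range n, 1 :=
        Finset.sum_le_sum fun i _ => desInd_le_one σ i
    _ < n + 1 := by simp

lemma card_descents_lt {n : ℕ} (hn : n ≠ 0) (a : ℕ) :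
    ((Finset.univ.filter fun σ : Equiv.Perm (Fin n) => descents σ < a).card : ℝ) =
      cumEuler n a := by
  have h := factorial_mul_card_descents_lt hn a n
  -- for `b = n` the terms with `j ≥ 1` are differences of a sequence constant on the range involved
  rw [Finset.sum_eq_single 0] at h
  · simp only [descents_lt hn, and_true, esymmRange_zero_right, pow_zero, Nat.sub_zero,
      Module.End.one_apply, Nat.cast_one, one_mul, cumEuler_of_le le_rfl] at h
    rw [mul_comm] at h
    exact mul_right_cancel₀ (by positivity) h
  · intro j hj hj0
    rw [Finset.mem_range] at hj
    rw [bdiff_pow_eq_zero (m := n - j) (fun k hk => cumEuler_of_le hk) hj0 (by omega) (k := n)]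
    simp
  · simp

lemma card_descents_inv_lt {n : ℕ} (hn : n ≠ 0) (a : ℕ) :
    ((Finset.univ.filter fun σ : Equiv.Perm (Fin n) => descents σ⁻¹ < a).card : ℝ) =
      cumEuler n a := by
  rw [← card_descents_lt hn]
  congr 1
  refine Finset.card_nbij' (fun σ => σ⁻¹) (fun σ => σ⁻¹) ?_ ?_ ?_ ?_ <;> intro σ <;> simp

lemma esymmRange_mul_bdiff_pow_reflect {n b j : ℕ} (hb : b ≤ n) (hj : j ≠ 0) (hjn : j ≤ n) :
    (esymmRange n j : ℝ) * (bdiff ^ j) (cumEuler (n - j)) (n - b) =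
      -((-1) ^ j * (esymmRange n j : ℝ) * (bdiff ^ j) (cumEuler (n - j)) b) := by
  rcases hjn.eq_or_lt with rfl | hjn
  · rw [esymmRange_self hj]; simp
  have hm : n - j ≠ 0 := by omega
  have hr := bdiff_pow_reflect (f := cumEuler (n - j)) (m := n - j)
    (c := (n - j).factorial) (fun k hk => cumEuler_reflect hm hk)
    (by rw [show n - j = n - j - 1 + 1 by omega, cumEuler_succ_zero])
    (fun k hk => cumEuler_of_le hk) hj (k := b) (by omega)
  rw [show n - j + j - b = n - b by omega] at hr
  rw [hr]
  ring

/-- The sum `∑ j, s ^ j * c(n, n - j) * (∇^j H_{n-j}) (a) * (∇^j H_{n-j}) (b)` for `H = cumEuler`: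
divided by `n !`, it counts the permutations `σ` with prescribed extreme descent numbers of `σ` and
`σ⁻¹`, where `s = 1` if both are small or both large, and `s = -1` in the mixed cases. -/
noncomputable def jointSum (n : ℕ) (s : ℝ) (a b : ℕ) : ℝ :=
  ∑ j ∈ Finset.range (n + 1), s ^ j * (esymmRange n j : ℝ) *
    ((bdiff ^ j) (cumEuler (n - j)) a * (bdiff ^ j) (cumEuler (n - j)) b)

lemma jointSum_reflect {n : ℕ} (hn : n ≠ 0) (s : ℝ) (a : ℕ) {b : ℕ} (hb : b ≤ n) :
    jointSum n s a (n - b) = n.factorial * cumEuler n a - jointSum n (-s) a b := by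
  unfold jointSum
  rw [Finset.sum_range_succ', Finset.sum_range_succ']
  have hterm : ∀ j ∈ Finset.range n,
      s ^ (j + 1) * (esymmRange n (j + 1) : ℝ) *
        ((bdiff ^ (j + 1)) (cumEuler (n - (j + 1))) a *
          (bdiff ^ (j + 1)) (cumEuler (n - (j + 1))) (n - b)) =
      -((-s) ^ (j + 1) * (esymmRange n (j + 1) : ℝ) *
        ((bdiff ^ (j + 1)) (cumEuler (n - (j + 1))) a *
          (bdiff ^ (j + 1)) (cumEuler (n - (j + 1))) b)) := by
    intro j hj
    rw [Finset.mem_range] at hj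
    have h := esymmRange_mul_bdiff_pow_reflect hb (Nat.succ_ne_zero j) hj
    rw [Nat.succ_eq_add_one] at h
    rw [neg_pow s]
    linear_combination s ^ (j + 1) * (bdiff ^ (j + 1)) (cumEuler (n - (j + 1))) a * h
  rw [Finset.sum_congr rfl hterm, Finset.sum_neg_distrib]
  have hrefl := cumEuler_reflect hn hb
  simp only [esymmRange_zero_right, pow_zero, Nat.sub_zero, Module.End.one_apply, Nat.cast_one,
    one_mul]
  linear_combination cumEuler n a * hrefl

lemma jointSum_comm (n : ℕ) (s : ℝ) (a b : ℕ) : jointSum n s a b = jointSum n s b a := by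
  unfold jointSum
  simp only [mul_comm ((bdiff ^ _) (cumEuler _) a)]

/-- The joint distribution function of the numbers of descents of `σ` and `σ⁻¹`. -/
theorem factorial_mul_card_descents_lt_lt {n : ℕ} (hn : n ≠ 0) (a b : ℕ) :
    (n.factorial : ℝ) *
      ((Finset.univ.filter fun σ : Equiv.Perm (Fin n) =>
        descents σ < a ∧ descents σ⁻¹ < b).card : ℝ) = jointSum n 1 a b := by
  rw [factorial_mul_card_descents_lt hn, jointSum]
  simp only [one_pow, one_mul]

lemma card_filter_and_le {α : Type*} [Fintype α] (p : α → Prop) [DecidablePred p] (f : α → ℕ)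
    (m : ℕ) :
    ((Finset.univ.filter fun x => p x ∧ m ≤ f x).card : ℝ) =
      (Finset.univ.filter p).card - (Finset.univ.filter fun x => p x ∧ f x < m).card := by
  rw [← Finset.card_filter_add_card_filter_not (s := Finset.univ.filter p) (fun x => f x < m),
    Finset.filter_filter, Finset.filter_filter]
  simp only [not_lt, Nat.cast_add]
  ring

theorem factorial_mul_card_descents_lt_le {n : ℕ} (hn : n ≠ 0) (a : ℕ) {b : ℕ} (hb : b ≤ n) :
    (n.factorial : ℝ) *
      ((Finset.univ.filter fun σ : Equiv.Perm (Fin n) =>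
        descents σ < a ∧ n - b ≤ descents σ⁻¹).card : ℝ) = jointSum n (-1) a b := by
  rw [card_filter_and_le (fun σ => descents σ < a) (fun σ => descents σ⁻¹), mul_sub,
    factorial_mul_card_descents_lt_lt hn, jointSum_reflect hn 1 a hb, card_descents_lt hn]
  ring

theorem factorial_mul_card_descents_le_lt {n : ℕ} (hn : n ≠ 0) {a : ℕ} (ha : a ≤ n) (b : ℕ) :
    (n.factorial : ℝ) *
      ((Finset.univ.filter fun σ : Equiv.Perm (Fin n) =>
        n - a ≤ descents σ ∧ descents σ⁻¹ < b).card : ℝ) = jointSum n (-1) a b := by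
  rw [jointSum_comm, ← factorial_mul_card_descents_lt_le hn b ha]
  congr 2
  refine Finset.card_nbij' (fun σ => σ⁻¹) (fun σ => σ⁻¹) ?_ ?_ ?_ ?_ <;> intro σ <;>
    simp [and_comm]

lemma card_le_descents {n : ℕ} (hn : n ≠ 0) {a : ℕ} (ha : a ≤ n) :
    ((Finset.univ.filter fun σ : Equiv.Perm (Fin n) => n - a ≤ descents σ).card : ℝ) =
      cumEuler n a := by
  have h := card_filter_and_le (fun _ : Equiv.Perm (Fin n) => True) (fun σ => descents σ) (n - a)
  simp only [true_and, Finset.filter_true, Finset.card_univ, Fintype.card_perm, Fintype.card_fin,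
    card_descents_lt hn] at h
  rw [h, ← cumEuler_reflect hn ha]
  ring

lemma card_le_descents_inv {n : ℕ} (hn : n ≠ 0) {a : ℕ} (ha : a ≤ n) :
    ((Finset.univ.filter fun σ : Equiv.Perm (Fin n) => n - a ≤ descents σ⁻¹).card : ℝ) =
      cumEuler n a := by
  rw [← card_le_descents hn ha]
  congr 1
  refine Finset.card_nbij' (fun σ => σ⁻¹) (fun σ => σ⁻¹) ?_ ?_ ?_ ?_ <;> intro σ <;> simp

theorem factorial_mul_card_descents_le_le {n : ℕ} (hn : n ≠ 0) {a b : ℕ} (ha : a ≤ n)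
    (hb : b ≤ n) :
    (n.factorial : ℝ) *
      ((Finset.univ.filter fun σ : Equiv.Perm (Fin n) =>
        n - a ≤ descents σ ∧ n - b ≤ descents σ⁻¹).card : ℝ) = jointSum n 1 a b := by
  rw [card_filter_and_le (fun σ => n - a ≤ descents σ) (fun σ => descents σ⁻¹), mul_sub,
    factorial_mul_card_descents_le_lt hn ha, jointSum_reflect hn (-1) a hb, card_le_descents hn ha,
    neg_neg]
  ring

/-! ### The function `L` and the solutions of `L' (t) = x` -/

/-- The derivative `1 / (1 - exp (-t)) - 1 / t` of `logLaplaceUnif` at `t ≠ 0`, that is, the mean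
of the exponential tilt by `t` of the uniform law on `[0, 1]`. -/
noncomputable def tiltedMean (t : ℝ) : ℝ := 1 / (1 - Real.exp (-t)) - 1 / t

lemma one_sub_exp_neg_pos {t : ℝ} (ht : 0 < t) : 0 < 1 - Real.exp (-t) := by
  have : Real.exp (-t) < 1 := by rw [Real.exp_lt_one_iff]; linarith
  linarith

lemma logLaplaceUnif_eq_add_neg (t : ℝ) : logLaplaceUnif t = t + logLaplaceUnif (-t) := by
  rcases eq_or_ne t 0 with rfl | ht
  · simp
  have h : (Real.exp t - 1) / t = Real.exp t * ((Real.exp (-t) - 1) / -t) := by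
    rw [Real.exp_neg]
    field_simp
    ring
  have hne : (Real.exp (-t) - 1) / -t ≠ 0 := by
    refine div_ne_zero ?_ (neg_ne_zero.2 ht)
    rw [sub_ne_zero, ne_eq, Real.exp_eq_one_iff]
    exact neg_ne_zero.2 ht
  simp only [logLaplaceUnif, ht, neg_eq_zero, if_false]
  rw [h, Real.log_mul (Real.exp_ne_zero _) hne, Real.log_exp]

lemma logLaplaceUnif_neg {t : ℝ} (ht : 0 < t) :
    logLaplaceUnif (-t) = Real.log ((1 - Real.exp (-t)) / t) := by
  simp only [logLaplaceUnif, neg_eq_zero, ht.ne', if_false]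
  congr 1
  rw [div_neg, ← neg_div, neg_sub]

lemma exp_logLaplaceUnif_neg {t : ℝ} (ht : 0 < t) :
    Real.exp (logLaplaceUnif (-t)) = (1 - Real.exp (-t)) / t := by
  rw [logLaplaceUnif_neg ht, Real.exp_log (div_pos (one_sub_exp_neg_pos ht) ht)]

lemma hasDerivAt_logLaplaceUnif_neg {t : ℝ} (ht : 0 < t) :
    HasDerivAt (fun s => logLaplaceUnif (-s)) (tiltedMean t - 1) t := by
  have h1 := one_sub_exp_neg_pos ht
  have h : HasDerivAt (fun s : ℝ => Real.log (1 - Real.exp (-s)) - Real.log s)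
      (tiltedMean t - 1) t := by
    have h2 : HasDerivAt (fun s : ℝ => 1 - Real.exp (-s)) (Real.exp (-t)) t := by
      simpa using ((hasDerivAt_neg t).exp).const_sub 1
    convert! (h2.log h1.ne').sub (Real.hasDerivAt_log ht.ne') using 1
    unfold tiltedMean
    field_simp
    ring
  refine h.congr_of_eventuallyEq ?_
  filter_upwards [lt_mem_nhds ht] with s hs
  rw [logLaplaceUnif_neg hs, Real.log_div (one_sub_exp_neg_pos hs).ne' hs.ne']

lemma hasDerivAt_logLaplaceUnif {t : ℝ} (ht : 0 < t) :
    HasDerivAt logLaplaceUnif (tiltedMean t) t := by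
  have h := (hasDerivAt_id t).add (hasDerivAt_logLaplaceUnif_neg ht)
  rw [add_sub_cancel] at h
  convert! h using 1
  ext s
  exact logLaplaceUnif_eq_add_neg s

/-- The symmetry `L(t) = t + L(-t)` on the level of derivatives. -/
lemma HasDerivAt.logLaplaceUnif_neg {t d : ℝ} (h : HasDerivAt logLaplaceUnif d t) :
    HasDerivAt logLaplaceUnif (1 - d) (-t) := by
  have h1 : HasDerivAt (fun s => logLaplaceUnif (-s)) (-d) (-t) := by
    have h' : HasDerivAt logLaplaceUnif d (-(-t)) := by rwa [neg_neg]
    simpa [Function.comp_def] using h'.scomp (-t) (hasDerivAt_neg (-t))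
  have h := (hasDerivAt_id (-t)).add h1
  rw [← sub_eq_add_neg] at h
  convert! h using 1
  ext s
  exact logLaplaceUnif_eq_add_neg s

lemma continuousOn_tiltedMean : ContinuousOn tiltedMean (Set.Ioi 0) := by
  unfold tiltedMean
  refine ContinuousOn.sub ?_ ?_
  · exact continuousOn_const.div (by fun_prop) fun t ht => (one_sub_exp_neg_pos ht).ne'
  · exact continuousOn_const.div continuousOn_id fun t ht => (Set.mem_Ioi.1 ht).ne'

/-- `L'` is strictly increasing since `sinh (t / 2) > t / 2`. -/
lemma strictMonoOn_tiltedMean : StrictMonoOn tiltedMean (Set.Ioi 0) := by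
  refine strictMonoOn_of_deriv_pos (convex_Ioi 0) continuousOn_tiltedMean fun t ht => ?_
  rw [interior_Ioi] at ht
  have ht : 0 < t := ht
  have h1 := one_sub_exp_neg_pos ht
  have h2 : HasDerivAt (fun s : ℝ => 1 - Real.exp (-s)) (Real.exp (-t)) t := by
    simpa using ((hasDerivAt_neg t).exp).const_sub 1
  have h3 : HasDerivAt tiltedMean
      (-Real.exp (-t) / (1 - Real.exp (-t)) ^ 2 - -1 / t ^ 2) t := by
    convert! (h2.inv h1.ne').sub (hasDerivAt_inv ht.ne') using 1
    · ext s; simp [tiltedMean]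
    · ring
  rw [h3.deriv]
  have h4 : t * Real.exp (-(t / 2)) < 1 - Real.exp (-t) := by
    have h5 := Real.self_lt_sinh_iff.2 (half_pos ht)
    rw [Real.sinh_eq] at h5
    have e1 : Real.exp (t / 2) * Real.exp (-(t / 2)) = 1 := by rw [← Real.exp_add]; simp
    have e2 : Real.exp (-(t / 2)) * Real.exp (-(t / 2)) = Real.exp (-t) := by
      rw [← Real.exp_add]; congr 1; ring
    nlinarith [Real.exp_pos (-(t / 2))]
  have h5 : t ^ 2 * Real.exp (-t) < (1 - Real.exp (-t)) ^ 2 := by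
    have e2 : Real.exp (-(t / 2)) ^ 2 = Real.exp (-t) := by
      rw [← Real.exp_nat_mul]; congr 1; push_cast; ring
    rw [← e2, ← mul_pow, e2]
    exact pow_lt_pow_left₀ h4 (by positivity) two_ne_zero
  have h6 : Real.exp (-t) / (1 - Real.exp (-t)) ^ 2 < 1 / t ^ 2 := by
    rw [div_lt_div_iff₀ (by positivity) (by positivity)]
    linarith
  rw [neg_div, neg_div]
  linarith

lemma half_lt_tiltedMean {t : ℝ} (ht : 0 < t) : 1 / 2 < tiltedMean t := by
  have h1 := one_sub_exp_neg_pos ht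
  have hmono : StrictMonoOn (fun s : ℝ => (2 + s) * Real.exp (-s) + s) (Set.Ici 0) := by
    refine strictMonoOn_of_deriv_pos (convex_Ici 0) (by fun_prop) fun s hs => ?_
    rw [interior_Ici] at hs
    have hs : 0 < s := hs
    have h2 : HasDerivAt (fun s : ℝ => (2 + s) * Real.exp (-s) + s)
        (1 * Real.exp (-s) + (2 + s) * (Real.exp (-s) * -1) + 1) s :=
      ((((hasDerivAt_id s).const_add 2)).mul ((hasDerivAt_neg s).exp)).add (hasDerivAt_id s)
    rw [h2.deriv]
    have h3 := Real.add_one_lt_exp hs.ne'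
    have h4 : Real.exp s * Real.exp (-s) = 1 := by rw [← Real.exp_add]; simp
    nlinarith [Real.exp_pos (-s)]
  have h2 := hmono (Set.mem_Ici.2 le_rfl) (Set.mem_Ici.2 ht.le) ht
  simp only [add_zero, neg_zero, Real.exp_zero, mul_one] at h2
  unfold tiltedMean
  rw [div_sub_div _ _ h1.ne' ht.ne', div_lt_div_iff₀ two_pos (by positivity)]
  nlinarith

lemma exists_tiltedMean_eq {x : ℝ} (hx : x ∈ Set.Ioo (1 / 2 : ℝ) 1) :
    ∃ t : ℝ, 0 < t ∧ tiltedMean t = x := by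
  obtain ⟨hx1, hx2⟩ := hx
  have hx3 : 0 < 1 - x := by linarith
  have hx4 : 2 < 1 / (1 - x) := by rw [lt_div_iff₀ hx3]; linarith
  set t₀ := (1 / (1 - x) - 2) / 2 with ht₀
  set t₁ := 1 / (1 - x) with ht₁
  have ht₀pos : 0 < t₀ := by linarith
  have hlt : t₀ ≤ t₁ := by linarith
  have hlow : tiltedMean t₀ ≤ x := by
    -- `exp t ≥ 1 + t + t ^ 2 / 2` gives `L' t ≤ 1 - 1 / (2 + t)`
    have h1 := one_sub_exp_neg_pos ht₀pos
    have hq := Real.quadratic_le_exp_of_nonneg ht₀pos.le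
    have h2 : tiltedMean t₀ ≤ 1 - 1 / (2 + t₀) := by
      unfold tiltedMean
      have h3 : 1 / (1 - Real.exp (-t₀)) ≤ 1 + 1 / t₀ - 1 / (2 + t₀) := by
        have e : 1 + 1 / t₀ - 1 / (2 + t₀) = (t₀ * (2 + t₀) + 2) / (t₀ * (2 + t₀)) := by
          field_simp; ring
        rw [e, div_le_div_iff₀ h1 (by positivity)]
        have h4 : Real.exp t₀ * Real.exp (-t₀) = 1 := by rw [← Real.exp_add]; simp
        nlinarith [Real.exp_pos (-t₀)]
      linarith
    have h3 : 1 - x ≤ 1 / (2 + t₀) := by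
      rw [le_div_iff₀ (by positivity)]
      have : (1 - x) * t₁ = 1 := by rw [ht₁]; field_simp
      nlinarith
    linarith
  have hhigh : x ≤ tiltedMean t₁ := by
    have ht₁pos : 0 < t₁ := by linarith
    have h1 := one_sub_exp_neg_pos ht₁pos
    have h2 : 1 ≤ 1 / (1 - Real.exp (-t₁)) := by
      rw [le_div_iff₀ h1]; linarith [Real.exp_pos (-t₁)]
    unfold tiltedMean
    rw [ht₁, one_div_one_div, ← ht₁]
    linarith
  obtain ⟨t, ht, htx⟩ := intermediate_value_Icc hlt
    (continuousOn_tiltedMean.mono fun s hs => ht₀pos.trans_le hs.1) ⟨hlow, hhigh⟩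
  exact ⟨t, ht₀pos.trans_le ht.1, htx⟩

/-- For `1/2 < x < 1` the equation `L'(t) = x` has exactly one real solution, and it is positive. -/
lemma exists_unique_deriv_logLaplaceUnif {x : ℝ} (hx : x ∈ Set.Ioo (1 / 2 : ℝ) 1) :
    ∃ t : ℝ, 0 < t ∧ tiltedMean t = x ∧ ∀ s, HasDerivAt logLaplaceUnif x s ↔ s = t := by
  obtain ⟨t, ht, htx⟩ := exists_tiltedMean_eq hx
  refine ⟨t, ht, htx, fun s => ⟨fun h => ?_, ?_⟩⟩
  · rcases lt_trichotomy s 0 with hs | rfl | hs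
    · have h1 := h.logLaplaceUnif_neg.unique (hasDerivAt_logLaplaceUnif (neg_pos.2 hs))
      have h2 := half_lt_tiltedMean (neg_pos.2 hs)
      have := hx.1
      linarith
    · have h1 := h.logLaplaceUnif_neg
      rw [neg_zero] at h1
      have := h1.unique h
      have := hx.1
      linarith
    · have h1 := h.unique (hasDerivAt_logLaplaceUnif hs)
      exact strictMonoOn_tiltedMean.injOn hs ht (h1.symm.trans htx.symm)
  · rintro rfl
    rw [← htx]
    exact hasDerivAt_logLaplaceUnif ht

/-! ### Exponential tilting of `cumEuler` -/

lemma sum_range_pow_mul_exp_le (n M : ℕ) {σ : ℝ} (hσ : 0 < σ) :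
    ∑ k ∈ Finset.range M, (k : ℝ) ^ n * Real.exp (-(σ * k)) ≤
      Real.exp σ * n.factorial / σ ^ (n + 1) := by
  rw [Finset.range_eq_Ico]
  exact sum_Ico_pow_mul_exp_neg_le hσ

lemma summable_pow_mul_exp (n : ℕ) {σ : ℝ} (hσ : 0 < σ) :
    Summable fun k : ℕ => (k : ℝ) ^ n * Real.exp (-(σ * k)) :=
  summable_of_sum_range_le (fun _ => by positivity) fun M => sum_range_pow_mul_exp_le n M hσ

lemma le_tsum_pow_mul_exp (n : ℕ) {σ : ℝ} (hσ : 0 < σ) :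
    Real.exp (-σ) * n.factorial / σ ^ (n + 1) ≤
      ∑' k : ℕ, (k : ℝ) ^ n * Real.exp (-(σ * k)) := by
  have hn : (0 : ℝ) < (n : ℝ) + 1 := by positivity
  have key := Real.integral_rpow_mul_exp_neg_mul_Ioi hn hσ
  simp only [add_sub_cancel_right, Real.rpow_natCast] at key
  have hval : (1 / σ) ^ ((n : ℝ) + 1) * Real.Gamma ((n : ℝ) + 1) = n.factorial / σ ^ (n + 1) := by
    rw [Real.Gamma_nat_eq_factorial, ← Nat.cast_succ, Real.rpow_natCast, one_div, inv_pow]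
    field_simp
  rw [hval] at key
  have hint : IntegrableOn (fun x : ℝ => x ^ n * Real.exp (-(σ * x))) (Set.Ioi 0) :=
    .of_integral_ne_zero (by rw [key]; positivity)
  have hlim := (intervalIntegral_tendsto_integral_Ioi 0 hint
    (tendsto_natCast_atTop_atTop (R := ℝ))).const_mul (Real.exp (-σ))
  rw [key, ← mul_div_assoc] at hlim
  refine le_of_tendsto' hlim fun M => ?_
  have h1 : ∫ x in ((1 : ℕ) : ℝ)..((M + 1 : ℕ) : ℝ), Real.exp (-(σ * x)) * (x - 1) ^ n ≤
      ∑ i ∈ Finset.Ico 1 (M + 1), Real.exp (-(σ * i)) * (i : ℝ) ^ n := by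
    refine integral_le_sum_mul_Ico_of_antitone_monotone (f := fun x => Real.exp (-(σ * x)))
      (g := fun x => x ^ n) (by omega) ?_ ?_ ?_ ?_
    · intro x _ y _ hxy
      exact Real.exp_le_exp.2 (neg_le_neg (by gcongr))
    · intro x hx y _ hxy
      exact pow_le_pow_left₀ (by simpa using hx.1) hxy n
    · positivity
    · simp only [Nat.cast_one, sub_self]; positivity
  have h2 : ∫ x in ((1 : ℕ) : ℝ)..((M + 1 : ℕ) : ℝ), Real.exp (-(σ * x)) * (x - 1) ^ n =
      Real.exp (-σ) * ∫ x in (0 : ℝ)..M, x ^ n * Real.exp (-(σ * x)) := by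
    have h3 := intervalIntegral.integral_comp_sub_right (a := ((1 : ℕ) : ℝ))
      (b := ((M + 1 : ℕ) : ℝ)) (fun x : ℝ => x ^ n * Real.exp (-(σ * x))) 1
    rw [show ((1 : ℕ) : ℝ) - 1 = 0 by simp, show ((M + 1 : ℕ) : ℝ) - 1 = M by simp] at h3
    rw [← h3, ← intervalIntegral.integral_const_mul]
    refine intervalIntegral.integral_congr fun x _ => ?_
    rw [show -(σ * x) = -σ + -(σ * (x - 1)) by ring, Real.exp_add]
    ring
  rw [← h2]
  refine h1.trans ?_
  simp only [mul_comm (Real.exp _)]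
  exact (summable_pow_mul_exp n hσ).sum_le_tsum _ fun i _ => by positivity

lemma hasSum_bdiff_mul_exp {f : ℕ → ℝ} {σ s : ℝ}
    (h : HasSum (fun k : ℕ => f k * Real.exp (-(σ * k))) s) :
    HasSum (fun k : ℕ => bdiff f k * Real.exp (-(σ * k))) ((1 - Real.exp (-σ)) * s) := by
  have h1 : HasSum (fun k : ℕ => seqShift f k * Real.exp (-(σ * k))) (Real.exp (-σ) * s) := by
    rw [← hasSum_nat_add_iff' 1]
    simp only [seqShift_succ, Finset.range_one, Finset.sum_singleton, seqShift_zero, zero_mul,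
      sub_zero]
    convert! h.mul_left (Real.exp (-σ)) using 1
    ext k
    push_cast
    rw [show -(σ * ((k : ℝ) + 1)) = -σ + -(σ * k) by ring, Real.exp_add]
    ring
  convert! h.sub h1 using 1
  · ext k
    simp [bdiff, sub_mul]
  · ring

lemma hasSum_bdiff_pow_mul_exp {f : ℕ → ℝ} {σ s : ℝ}
    (h : HasSum (fun k : ℕ => f k * Real.exp (-(σ * k))) s) (n : ℕ) :
    HasSum (fun k : ℕ => (bdiff ^ n) f k * Real.exp (-(σ * k)))
      ((1 - Real.exp (-σ)) ^ n * s) := by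
  induction n with
  | zero => simpa using h
  | succ n ih =>
    rw [pow_succ', pow_succ', mul_assoc]
    exact hasSum_bdiff_mul_exp ih

/-- The weight `cumEuler n a * exp (-σ a)` of the exponential tilt of `cumEuler n` by `-σ`. -/
noncomputable def tiltedEuler (n : ℕ) (σ : ℝ) (a : ℕ) : ℝ := cumEuler n a * Real.exp (-(σ * a))

lemma tiltedEuler_nonneg (n : ℕ) (σ : ℝ) (a : ℕ) : 0 ≤ tiltedEuler n σ a :=
  mul_nonneg (cumEuler_nonneg n a) (Real.exp_pos _).le

lemma tiltedEuler_succ_pos (n : ℕ) (σ : ℝ) (a : ℕ) : 0 < tiltedEuler n σ (a + 1) :=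
  mul_pos (cumEuler_pos n a) (Real.exp_pos _)

lemma tiltedEuler_logConcave (n : ℕ) (σ : ℝ) (a : ℕ) :
    tiltedEuler n σ a * tiltedEuler n σ (a + 2) ≤ tiltedEuler n σ (a + 1) ^ 2 := by
  have h := cumEuler_logConcave n a
  have e : Real.exp (-(σ * (a : ℕ))) * Real.exp (-(σ * (a + 2 : ℕ))) =
      Real.exp (-(σ * (a + 1 : ℕ))) ^ 2 := by
    rw [← Real.exp_add, ← Real.exp_nat_mul]
    congr 1
    push_cast
    ring
  unfold tiltedEuler
  rw [mul_mul_mul_comm, e, mul_pow]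
  gcongr

lemma summable_tiltedEuler (n : ℕ) {σ : ℝ} (hσ : 0 < σ) : Summable (tiltedEuler n σ) :=
  (hasSum_bdiff_pow_mul_exp (summable_pow_mul_exp n hσ).hasSum n).summable

lemma tsum_tiltedEuler (n : ℕ) {σ : ℝ} (hσ : 0 < σ) :
    ∑' a, tiltedEuler n σ a =
      (1 - Real.exp (-σ)) ^ n * ∑' k : ℕ, (k : ℝ) ^ n * Real.exp (-(σ * k)) :=
  (hasSum_bdiff_pow_mul_exp (summable_pow_mul_exp n hσ).hasSum n).tsum_eq

lemma exp_mul_logLaplaceUnif_neg (n : ℕ) {σ : ℝ} (hσ : 0 < σ) :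
    Real.exp (n * logLaplaceUnif (-σ)) = (1 - Real.exp (-σ)) ^ n / σ ^ n := by
  rw [Real.exp_nat_mul, exp_logLaplaceUnif_neg hσ, div_pow]

lemma tsum_tiltedEuler_le (n : ℕ) {σ : ℝ} (hσ : 0 < σ) :
    ∑' a, tiltedEuler n σ a ≤
      Real.exp σ / σ * n.factorial * Real.exp (n * logLaplaceUnif (-σ)) := by
  have h := Real.tsum_le_of_sum_range_le (fun _ => by positivity)
    fun M => sum_range_pow_mul_exp_le n M hσ
  have h1 := one_sub_exp_neg_pos hσ
  rw [tsum_tiltedEuler n hσ, exp_mul_logLaplaceUnif_neg n hσ]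
  calc _ ≤ (1 - Real.exp (-σ)) ^ n * (Real.exp σ * n.factorial / σ ^ (n + 1)) := by gcongr
    _ = _ := by rw [pow_succ]; field_simp

lemma le_tsum_tiltedEuler (n : ℕ) {σ : ℝ} (hσ : 0 < σ) :
    Real.exp (-σ) / σ * n.factorial * Real.exp (n * logLaplaceUnif (-σ)) ≤
      ∑' a, tiltedEuler n σ a := by
  have h1 := one_sub_exp_neg_pos hσ
  rw [tsum_tiltedEuler n hσ, exp_mul_logLaplaceUnif_neg n hσ]
  calc _ = (1 - Real.exp (-σ)) ^ n * (Real.exp (-σ) * n.factorial / σ ^ (n + 1)) := by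
        rw [pow_succ]; field_simp
    _ ≤ _ := by gcongr; exact le_tsum_pow_mul_exp n hσ

/-- The weights with `a ≥ n` form a geometric series, since `cumEuler n` is constant there. -/
lemma tsum_tiltedEuler_le_of_le (n : ℕ) {σ M : ℝ} (hσ : 0 < σ) (hM : ∀ a, tiltedEuler n σ a ≤ M) :
    ∑' a, tiltedEuler n σ a ≤ (n + 1 / (1 - Real.exp (-σ))) * M := by
  have h1 := one_sub_exp_neg_pos hσ
  rw [← (summable_tiltedEuler n hσ).sum_add_tsum_nat_add n, add_mul]
  refine add_le_add ?_ ?_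
  · simpa using Finset.sum_le_card_nsmul (Finset.range n) _ M fun a _ => hM a
  · have h2 : ∀ k, tiltedEuler n σ (k + n) = tiltedEuler n σ n * Real.exp (-σ) ^ k := by
      intro k
      unfold tiltedEuler
      rw [cumEuler_of_le le_rfl, cumEuler_of_le (Nat.le_add_left n k), mul_assoc,
        ← Real.exp_nat_mul, ← Real.exp_add]
      congr 2
      push_cast
      ring
    simp only [h2]
    rw [tsum_mul_left, tsum_geometric_of_lt_one (Real.exp_pos _).le (by linarith), mul_comm,
      one_div]
    gcongr
    exact hM n

section LogConcave

variable {w : ℕ → ℝ}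

lemma antitone_after_of_logConcave (hpos : ∀ i, 0 < w (i + 1))
    (hlc : ∀ i, w i * w (i + 2) ≤ w (i + 1) ^ 2) {a : ℕ} (ha : w (a + 1) ≤ w a) {i : ℕ}
    (hi : a ≤ i) : w i ≤ w a := by
  have key : ∀ i, a ≤ i → w (i + 1) ≤ w i := by
    intro i hi
    induction i, hi using Nat.le_induction with
    | base => exact ha
    | succ i hi ih =>
      have h0 : 0 < w i := (hpos i).trans_le ih
      refine le_of_mul_le_mul_left ((hlc i).trans ?_) h0
      rw [sq]
      exact mul_le_mul_of_nonneg_right ih (hpos i).le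
  induction i, hi using Nat.le_induction with
  | base => exact le_rfl
  | succ i hi ih => exact (key i hi).trans ih

lemma monotone_before_of_logConcave (hpos : ∀ i, 0 < w (i + 1))
    (hlc : ∀ i, w i * w (i + 2) ≤ w (i + 1) ^ 2) {a : ℕ} (ha : w a ≤ w (a + 1)) {i : ℕ}
    (hi : i ≤ a) : w i ≤ w a := by
  induction a with
  | zero => rw [Nat.le_zero.1 hi]
  | succ a ih =>
    have h1 : w a ≤ w (a + 1) := by
      refine le_of_mul_le_mul_right ((hlc a).trans ?_) (hpos (a + 1))
      rw [sq]
      exact mul_le_mul_of_nonneg_left ha (hpos a).le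
    rcases hi.eq_or_lt with rfl | hi
    · exact le_rfl
    · exact (ih h1 (by omega)).trans h1

end LogConcave

/-- A Chernoff-type bound: the tilted weights cannot all be so small as they would be if their
maximum were attained away from the mean of the tilted law. -/
lemma eventually_not_forall_tiltedEuler_le {σ ε β : ℝ} (hσ : 0 < σ) (hσε : 0 < σ + ε)
    (h : ε * β + logLaplaceUnif (-(σ + ε)) < logLaplaceUnif (-σ)) :
    ∀ᶠ n : ℕ in atTop, ¬ ∀ a, tiltedEuler n σ a ≤
      Real.exp (ε * β * n) * ∑' i, tiltedEuler n (σ + ε) i := by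
  -- if all weights were that small, `exp (δ n)` would be bounded by a linear function of `n`
  set δ := logLaplaceUnif (-σ) - (ε * β + logLaplaceUnif (-(σ + ε))) with hδ
  have hδ0 : 0 < δ := by linarith
  set K := 1 / (1 - Real.exp (-σ)) with hK
  set C := Real.exp (σ + ε) / (σ + ε) with hC
  have hlim : Tendsto (fun n : ℕ => ((n : ℝ) + K) * C * Real.exp (-(δ * n))) atTop (nhds 0) := by
    have h1 : Tendsto (fun x : ℝ => x ^ 1 * Real.exp (-(δ * x))) atTop (nhds 0) := by
      have := Real.tendsto_pow_mul_exp_neg_atTop_nhds_zero 1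
      have h2 := (this.comp (tendsto_id.const_mul_atTop hδ0)).const_mul δ⁻¹
      rw [mul_zero] at h2
      refine h2.congr fun x => ?_
      simp only [Function.comp, id, pow_one]
      field_simp
    have h2 : Tendsto (fun x : ℝ => Real.exp (-(δ * x))) atTop (nhds 0) :=
      Real.tendsto_exp_neg_atTop_nhds_zero.comp (tendsto_id.const_mul_atTop hδ0)
    have h3 := ((h1.mul_const C).add (h2.const_mul (K * C))).comp
      (tendsto_natCast_atTop_atTop (R := ℝ))
    rw [zero_mul, mul_zero, add_zero] at h3
    refine h3.congr fun n => ?_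
    simp only [Function.comp]
    ring
  have hpos : 0 < Real.exp (-σ) / σ := by positivity
  filter_upwards [hlim.eventually (gt_mem_nhds hpos)] with n hn hall
  have h1 := one_sub_exp_neg_pos hσ
  have hK0 : 0 < K := by positivity
  have h2 := (le_tsum_tiltedEuler n hσ).trans (tsum_tiltedEuler_le_of_le n hσ hall)
  have h3 := tsum_tiltedEuler_le n hσε
  have h4 : Real.exp (-σ) / σ * n.factorial * Real.exp (n * logLaplaceUnif (-σ)) ≤
      (n + K) * (Real.exp (ε * β * n) *
        (C * n.factorial * Real.exp (n * logLaplaceUnif (-(σ + ε))))) := by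
    refine h2.trans ?_
    gcongr
  have h5 : Real.exp (ε * β * n) * Real.exp (n * logLaplaceUnif (-(σ + ε))) =
      Real.exp (-(δ * n)) * Real.exp (n * logLaplaceUnif (-σ)) := by
    rw [← Real.exp_add, ← Real.exp_add]
    congr 1
    rw [hδ]
    ring
  have h6 : (n + K) * (Real.exp (ε * β * n) *
        (C * n.factorial * Real.exp (n * logLaplaceUnif (-(σ + ε))))) =
      (n + K) * C * Real.exp (-(δ * n)) * (n.factorial * Real.exp (n * logLaplaceUnif (-σ))) := by
    linear_combination ((n : ℝ) + K) * C * n.factorial * h5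
  rw [h6, mul_assoc (Real.exp (-σ) / σ)] at h4
  exact absurd (le_of_mul_le_mul_right h4 (by positivity)) (not_le.2 hn)

lemma hasDerivAt_mul_add_logLaplaceUnif_neg (β : ℝ) {σ : ℝ} (hσ : 0 < σ) :
    HasDerivAt (fun s => β * s + logLaplaceUnif (-s)) (β - (1 - tiltedMean σ)) σ := by
  convert! ((hasDerivAt_id σ).const_mul β).add (hasDerivAt_logLaplaceUnif_neg hσ) using 1
  ring

/-- To the left of the mean of the tilted law, the tilted weights increase. -/
lemma eventually_forall_tiltedEuler_lt_succ {σ β : ℝ} (hσ : 0 < σ) (hβ : β < 1 - tiltedMean σ) :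
    ∀ᶠ n : ℕ in atTop, ∀ a : ℕ, (a : ℝ) ≤ β * n → tiltedEuler n σ a < tiltedEuler n σ (a + 1) := by
  obtain ⟨ε, hε, hlt⟩ : ∃ ε : ℝ, 0 < ε ∧
      ε * β + logLaplaceUnif (-(σ + ε)) < logLaplaceUnif (-σ) := by
    have h := (hasDerivAt_iff_tendsto_slope.1 (hasDerivAt_mul_add_logLaplaceUnif_neg β hσ)).eventually
      (gt_mem_nhds (by linarith : β - (1 - tiltedMean σ) < 0))
    have h' := (h.filter_mono (nhdsGT_le_nhdsNE σ)).and self_mem_nhdsWithin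
    obtain ⟨s, hs, hs'⟩ := h'.exists
    have hs' : σ < s := hs'
    rw [slope_def_field, div_lt_iff₀ (by linarith)] at hs
    refine ⟨s - σ, by linarith, ?_⟩
    rw [add_sub_cancel]
    linarith
  filter_upwards [eventually_not_forall_tiltedEuler_le hσ (by linarith) hlt] with n hn a ha
  by_contra hcon
  refine hn ?_
  have hle : ∀ i ≤ a, tiltedEuler n σ i ≤
      Real.exp (ε * β * n) * ∑' i, tiltedEuler n (σ + ε) i := by
    intro i hi
    have h1 : tiltedEuler n σ i = Real.exp (ε * i) * tiltedEuler n (σ + ε) i := by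
      unfold tiltedEuler
      rw [mul_left_comm, ← Real.exp_add]
      ring_nf
    have hi' : (i : ℝ) ≤ a := by exact_mod_cast hi
    rw [h1, mul_assoc ε]
    refine mul_le_mul ?_ ?_ (tiltedEuler_nonneg _ _ _) (Real.exp_pos _).le
    · exact Real.exp_le_exp.2 (mul_le_mul_of_nonneg_left (hi'.trans ha) hε.le)
    · exact (summable_tiltedEuler n (by linarith)).le_tsum i fun j _ => tiltedEuler_nonneg _ _ _
  intro i
  rcases le_total i a with hi | hi
  · exact hle i hi
  · exact (antitone_after_of_logConcave (tiltedEuler_succ_pos n σ) (tiltedEuler_logConcave n σ)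
      (not_lt.1 hcon) hi).trans (hle a le_rfl)

/-- To the right of the mean of the tilted law, the tilted weights decrease. -/
lemma eventually_forall_tiltedEuler_succ_lt {σ β : ℝ} (hσ : 0 < σ) (hβ : 1 - tiltedMean σ < β) :
    ∀ᶠ n : ℕ in atTop, ∀ a : ℕ, β * n ≤ (a : ℝ) → tiltedEuler n σ (a + 1) < tiltedEuler n σ a := by
  obtain ⟨ε, hε, hσε, hlt⟩ : ∃ ε : ℝ, ε < 0 ∧ 0 < σ + ε ∧
      ε * β + logLaplaceUnif (-(σ + ε)) < logLaplaceUnif (-σ) := by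
    have h := (hasDerivAt_iff_tendsto_slope.1 (hasDerivAt_mul_add_logLaplaceUnif_neg β hσ)).eventually
      (lt_mem_nhds (by linarith : 0 < β - (1 - tiltedMean σ)))
    have h' := ((h.filter_mono (nhdsLT_le_nhdsNE σ)).and self_mem_nhdsWithin).and
      (mem_nhdsWithin_of_mem_nhds (lt_mem_nhds hσ))
    obtain ⟨s, ⟨hs, hs'⟩, hs0⟩ := h'.exists
    have hs' : s < σ := hs'
    have hs0 : 0 < s := hs0
    rw [slope_comm, slope_def_field, lt_div_iff₀ (by linarith)] at hs
    refine ⟨s - σ, by linarith, by linarith, ?_⟩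
    rw [add_sub_cancel]
    linarith
  filter_upwards [eventually_not_forall_tiltedEuler_le hσ hσε hlt] with n hn a ha
  by_contra hcon
  refine hn ?_
  have hle : ∀ i, a ≤ i → tiltedEuler n σ i ≤
      Real.exp (ε * β * n) * ∑' i, tiltedEuler n (σ + ε) i := by
    intro i hi
    have h1 : tiltedEuler n σ i = Real.exp (ε * i) * tiltedEuler n (σ + ε) i := by
      unfold tiltedEuler
      rw [mul_left_comm, ← Real.exp_add]
      ring_nf
    have hi' : (a : ℝ) ≤ i := by exact_mod_cast hi
    rw [h1, mul_assoc ε]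
    refine mul_le_mul ?_ ?_ (tiltedEuler_nonneg _ _ _) (Real.exp_pos _).le
    · exact Real.exp_le_exp.2 (mul_le_mul_of_nonpos_left (ha.trans hi') hε.le)
    · exact (summable_tiltedEuler n hσε).le_tsum i fun j _ => tiltedEuler_nonneg _ _ _
  intro i
  rcases le_total i a with hi | hi
  · exact (monotone_before_of_logConcave (tiltedEuler_succ_pos n σ) (tiltedEuler_logConcave n σ)
      (not_lt.1 hcon) hi).trans (hle a le_rfl)
  · exact hle i hi

lemma tiltedEuler_succ (n : ℕ) (σ : ℝ) (a : ℕ) :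
    tiltedEuler n σ (a + 1) =
      Real.exp (-σ) * cumEuler n (a + 1) * Real.exp (-(σ * a)) := by
  unfold tiltedEuler
  push_cast
  rw [show -(σ * ((a : ℝ) + 1)) = -σ + -(σ * a) by ring, Real.exp_add]
  ring

/-- Consecutive values of the distribution function of the number of descents near `α n` have
asymptotic ratio `exp (-τ)`, where `τ` is the tilt for which the mean is `α`. -/
theorem tendsto_cumEuler_div_succ {τ : ℝ} (hτ : 0 < τ) {N a : ℕ → ℕ}
    (hN : Tendsto N atTop atTop)
    (ha : Tendsto (fun n => (a n : ℝ) / N n) atTop (nhds (1 - tiltedMean τ))) :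
    Tendsto (fun n => cumEuler (N n) (a n) / cumEuler (N n) (a n + 1)) atTop
      (nhds (Real.exp (-τ))) := by
  have hcont : Tendsto (fun s : ℝ => Real.exp (-s)) (nhds τ) (nhds (Real.exp (-τ))) :=
    (by fun_prop : Continuous fun s : ℝ => Real.exp (-s)).continuousAt
  have hN0 : ∀ᶠ n in atTop, (0 : ℝ) < N n := by
    filter_upwards [hN.eventually (eventually_gt_atTop 0)] with n hn
    exact_mod_cast hn
  rw [tendsto_order]
  constructor
  · intro u hu
    obtain ⟨σ, hσu, hσ⟩ := (((hcont.eventually (lt_mem_nhds hu)).filter_mono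
      nhdsWithin_le_nhds).and (self_mem_nhdsWithin (s := Set.Ioi τ))).exists
    have hσ : τ < σ := hσ
    have hlt := strictMonoOn_tiltedMean hτ (hτ.trans hσ) hσ
    obtain ⟨β, hβ1, hβ2⟩ := exists_between (sub_lt_sub_left hlt 1)
    filter_upwards [hN.eventually (eventually_forall_tiltedEuler_succ_lt (hτ.trans hσ) hβ1),
      ha.eventually (lt_mem_nhds hβ2), hN0] with n hn hβn hn0
    rw [lt_div_iff₀ hn0] at hβn
    have h1 := hn (a n) hβn.le
    rw [tiltedEuler_succ, tiltedEuler] at h1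
    have h2 := lt_of_mul_lt_mul_right h1 (Real.exp_pos _).le
    refine hσu.trans ?_
    rwa [lt_div_iff₀ (cumEuler_pos _ _)]
  · intro u hu
    obtain ⟨σ, ⟨hσu, hσ⟩, hσ0⟩ := (((hcont.eventually (gt_mem_nhds hu)).filter_mono
      nhdsWithin_le_nhds).and (self_mem_nhdsWithin (s := Set.Iio τ))).and
      (mem_nhdsWithin_of_mem_nhds (lt_mem_nhds hτ)) |>.exists
    have hσ : σ < τ := hσ
    have hσ0 : 0 < σ := hσ0
    have hlt := strictMonoOn_tiltedMean hσ0 hτ hσ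
    obtain ⟨β, hβ1, hβ2⟩ := exists_between (sub_lt_sub_left hlt 1)
    filter_upwards [hN.eventually (eventually_forall_tiltedEuler_lt_succ hσ0 hβ2),
      ha.eventually (gt_mem_nhds hβ1), hN0] with n hn hβn hn0
    rw [div_lt_iff₀ hn0] at hβn
    have h1 := hn (a n) hβn.le
    rw [tiltedEuler_succ, tiltedEuler] at h1
    have h2 := lt_of_mul_lt_mul_right h1 (Real.exp_pos _).le
    refine lt_of_lt_of_le ?_ hσu.le
    rwa [div_lt_iff₀ (cumEuler_pos _ _)]

/-! ### Asymptotics of the Stirling numbers -/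

lemma pow_add_mul_pow_le (n k : ℕ) : n ^ (k + 1) + (k + 1) * n ^ k ≤ (n + 1) ^ (k + 1) := by
  induction k with
  | zero => simp
  | succ k ih =>
    have h := Nat.mul_le_mul_right (n + 1) ih
    rw [← pow_succ] at h
    refine le_trans ?_ h
    have : 0 ≤ (k + 1) * n ^ k := Nat.zero_le _
    ring_nf
    nlinarith

lemma pow_le_pow_add_mul_pow (n k : ℕ) :
    (n + 1) ^ (k + 1) ≤ n ^ (k + 1) + (k + 1) * (n + 1) ^ k := by
  induction k with
  | zero => simp
  | succ k ih =>
    have h := Nat.mul_le_mul_right (n + 1) ih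
    rw [← pow_succ] at h
    refine h.trans ?_
    have h2 : n ^ (k + 1) ≤ (n + 1) ^ (k + 1) := Nat.pow_le_pow_left (Nat.le_succ n) _
    calc (n ^ (k + 1) + (k + 1) * (n + 1) ^ k) * (n + 1)
        = n ^ (k + 1 + 1) + (k + 1) * (n + 1) ^ (k + 1) + n ^ (k + 1) := by ring
      _ ≤ n ^ (k + 1 + 1) + (k + 1) * (n + 1) ^ (k + 1) + (n + 1) ^ (k + 1) := by gcongr
      _ = _ := by ring

lemma esymmRange_le (n j : ℕ) : 2 ^ j * j.factorial * esymmRange n j ≤ n ^ (2 * j) := by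
  induction n generalizing j with
  | zero => cases j <;> simp
  | succ n ih =>
    cases j with
    | zero => simp
    | succ j =>
      have h1 := ih (j + 1)
      have h2 := Nat.mul_le_mul_left ((2 * j + 1 + 1) * n) (ih j)
      have h3 := pow_add_mul_pow_le n (2 * j + 1)
      rw [esymmRange_succ_succ, Nat.factorial_succ] at *
      calc _ = 2 ^ (j + 1) * ((j + 1) * j.factorial) * esymmRange n (j + 1) +
            (2 * j + 1 + 1) * n * (2 ^ j * j.factorial * esymmRange n j) := by ring
        _ ≤ n ^ (2 * (j + 1)) + (2 * j + 1 + 1) * n * n ^ (2 * j) := add_le_add h1 h2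
        _ = n ^ (2 * j + 1 + 1) + (2 * j + 1 + 1) * n ^ (2 * j + 1) := by ring
        _ ≤ _ := h3

lemma le_esymmRange (n j : ℕ) :
    (n - 2 * j) ^ (2 * j) ≤ 2 ^ j * j.factorial * esymmRange n j := by
  induction n generalizing j with
  | zero => cases j <;> simp
  | succ n ih =>
    cases j with
    | zero => simp
    | succ j =>
      rcases Nat.lt_or_ge n (2 * j + 2) with hn | hn
      · rw [show n + 1 - 2 * (j + 1) = 0 by omega, zero_pow (by omega)]
        exact Nat.zero_le _
      obtain ⟨p, rfl⟩ : ∃ p, n = p + (2 * j + 2) := ⟨n - (2 * j + 2), by omega⟩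
      have h1 := ih (j + 1)
      have h2 := Nat.mul_le_mul_left ((2 * j + 1 + 1) * (p + 1)) (ih j)
      have h3 := pow_le_pow_add_mul_pow p (2 * j + 1)
      rw [show p + (2 * j + 2) - 2 * (j + 1) = p by omega] at h1
      rw [show p + (2 * j + 2) - 2 * j = p + 2 by omega] at h2
      rw [show p + (2 * j + 2) + 1 - 2 * (j + 1) = p + 1 by omega]
      rw [esymmRange_succ_succ, Nat.factorial_succ] at *
      have h4 : (p + 1) ^ (2 * j) ≤ (p + 2) ^ (2 * j) := Nat.pow_le_pow_left (by omega) _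
      calc (p + 1) ^ (2 * (j + 1)) = (p + 1) ^ (2 * j + 1 + 1) := by ring
        _ ≤ p ^ (2 * j + 1 + 1) + (2 * j + 1 + 1) * (p + 1) ^ (2 * j + 1) := by simpa using h3
        _ = p ^ (2 * (j + 1)) + (2 * j + 1 + 1) * (p + 1) * (p + 1) ^ (2 * j) := by ring
        _ ≤ p ^ (2 * (j + 1)) + (2 * j + 1 + 1) * (p + 1) * (p + 2) ^ (2 * j) := by gcongr
        _ ≤ _ := add_le_add h1 h2
        _ ≤ 2 ^ (j + 1) * ((j + 1) * j.factorial) * esymmRange (p + (2 * j + 2)) (j + 1) +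
            (2 * j + 1 + 1) * (p + (2 * j + 2)) *
              (2 ^ j * j.factorial * esymmRange (p + (2 * j + 2)) j) := by
          gcongr; omega
        _ = _ := by ring

/-- The weight `c(n, n - j) / n ^ (2 j)`. -/
noncomputable def stirlingWeight (n j : ℕ) : ℝ := esymmRange n j / (n : ℝ) ^ (2 * j)

lemma stirlingWeight_nonneg (n j : ℕ) : 0 ≤ stirlingWeight n j := by
  unfold stirlingWeight; positivity

lemma stirlingWeight_le (n j : ℕ) : stirlingWeight n j ≤ (1 / 2) ^ j / j.factorial := by
  unfold stirlingWeight
  have h : (2 : ℝ) ^ j * j.factorial * esymmRange n j ≤ (n : ℝ) ^ (2 * j) := by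
    exact_mod_cast esymmRange_le n j
  rw [one_div, inv_pow, ← one_div, div_div]
  refine div_le_of_le_mul₀ (by positivity) (by positivity) ?_
  rw [one_div_mul_eq_div, le_div_iff₀ (by positivity)]
  linarith

lemma tendsto_stirlingWeight (j : ℕ) :
    Tendsto (fun n => stirlingWeight n j) atTop (nhds ((1 / 2) ^ j / j.factorial)) := by
  have hlim : Tendsto (fun n : ℕ => (1 - (2 * j : ℝ) / n) ^ (2 * j) * ((1 / 2) ^ j / j.factorial))
      atTop (nhds ((1 / 2) ^ j / j.factorial)) := by
    have h := ((tendsto_const_div_atTop_nhds_zero_nat (2 * j : ℝ)).const_sub 1).pow (2 * j)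
    simpa using h.mul_const ((1 / 2 : ℝ) ^ j / j.factorial)
  refine tendsto_of_tendsto_of_tendsto_of_le_of_le' hlim tendsto_const_nhds ?_
    (Eventually.of_forall fun n => stirlingWeight_le n j)
  filter_upwards [eventually_ge_atTop (2 * j + 1)] with n hn
  have h : ((n : ℝ) - 2 * j) ^ (2 * j) ≤ (2 : ℝ) ^ j * j.factorial * esymmRange n j := by
    have := le_esymmRange n j
    have h2 : (((n - 2 * j : ℕ) : ℝ)) = (n : ℝ) - 2 * j := by
      rw [Nat.cast_sub (by omega)]; push_cast; ring
    rw [← h2]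
    exact_mod_cast this
  have hn0 : (0 : ℝ) < n := by exact_mod_cast (by omega : 0 < n)
  have e : (1 - (2 * j : ℝ) / n) = ((n : ℝ) - 2 * j) / n := by field_simp
  unfold stirlingWeight
  rw [e, div_pow, one_div, inv_pow, ← one_div, div_div, div_mul_div_comm, mul_one,
    div_le_div_iff₀ (by positivity) (by positivity)]
  calc _ ≤ ((2 : ℝ) ^ j * j.factorial * esymmRange n j) * (n : ℝ) ^ (2 * j) := by gcongr
    _ = _ := by ring

/-! ### Asymptotics of the differences of `cumEuler` -/

section Differences

variable {τ : ℝ} {a : ℕ → ℕ}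

lemma tendsto_atTop_of_div {α : ℝ} (hα : 0 < α)
    (ha : Tendsto (fun n => (a n : ℝ) / n) atTop (nhds α)) : Tendsto a atTop atTop := by
  rw [← tendsto_natCast_atTop_iff (R := ℝ)]
  refine (ha.pos_mul_atTop hα tendsto_natCast_atTop_atTop).congr' ?_
  filter_upwards [eventually_gt_atTop 0] with n hn
  have : (n : ℝ) ≠ 0 := by positivity
  field_simp

lemma tendsto_sub_div_sub {α : ℝ} (hα : 0 < α)
    (ha : Tendsto (fun n => (a n : ℝ) / n) atTop (nhds α)) (c i : ℕ) :
    Tendsto (fun n => ((a n - i : ℕ) : ℝ) / ((n - c : ℕ) : ℝ)) atTop (nhds α) := by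
  have h1 : Tendsto (fun n : ℕ => ((a n : ℝ) / n - (i : ℝ) / n) / (1 - (c : ℝ) / n)) atTop
      (nhds ((α - 0) / (1 - 0))) :=
    (ha.sub (tendsto_const_div_atTop_nhds_zero_nat (i : ℝ))).div
      ((tendsto_const_div_atTop_nhds_zero_nat (c : ℝ)).const_sub 1) (by norm_num)
  rw [sub_zero, sub_zero, div_one] at h1
  refine h1.congr' ?_
  filter_upwards [eventually_ge_atTop (c + 1),
    (tendsto_atTop_of_div hα ha).eventually (eventually_ge_atTop i)] with n hn hi
  have hn0 : (n : ℝ) ≠ 0 := by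
    have : 0 < n := by omega
    positivity
  rw [Nat.cast_sub hi, Nat.cast_sub (by omega), ← sub_div, div_div, mul_sub, mul_one,
    mul_div_cancel₀ _ hn0]

lemma tendsto_cumEuler_sub_div (hτ : 0 < τ) (hτ1 : tiltedMean τ < 1)
    (ha : Tendsto (fun n => (a n : ℝ) / n) atTop (nhds (1 - tiltedMean τ))) (c i : ℕ) :
    Tendsto (fun n => cumEuler (n - c) (a n - (i + 1)) / cumEuler (n - c) (a n - i)) atTop
      (nhds (Real.exp (-τ))) := by
  have hα : 0 < 1 - tiltedMean τ := by linarith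
  refine (tendsto_cumEuler_div_succ hτ (tendsto_sub_atTop_nat c)
    (tendsto_sub_div_sub hα ha c (i + 1))).congr' ?_
  filter_upwards [(tendsto_atTop_of_div hα ha).eventually (eventually_ge_atTop (i + 1))] with n hn
  rw [show a n - (i + 1) + 1 = a n - i by omega]

/-- By the recurrence, the reciprocal of this ratio is, up to `O(1 / n)`, `α + (1 - α) r` with
`α = a / n` and `r` a ratio of consecutive values, tending to `exp (-τ)`. -/
lemma tendsto_mul_cumEuler_div (hτ : 0 < τ) (hτ1 : tiltedMean τ < 1)
    (ha : Tendsto (fun n => (a n : ℝ) / n) atTop (nhds (1 - tiltedMean τ))) (c : ℕ) :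
    Tendsto (fun n : ℕ => n * cumEuler (n - (c + 1)) (a n) / cumEuler (n - c) (a n)) atTop
      (nhds (τ / (1 - Real.exp (-τ)))) := by
  have hα : 0 < 1 - tiltedMean τ := by linarith
  have h1 := one_sub_exp_neg_pos hτ
  have hlim : Tendsto (fun n : ℕ => (a n : ℝ) / n + (1 - (c : ℝ) / n - (a n : ℝ) / n) *
      (cumEuler (n - (c + 1)) (a n - 1) / cumEuler (n - (c + 1)) (a n))) atTop
      (nhds ((1 - Real.exp (-τ)) / τ)) := by
    have h := ha.add ((((tendsto_const_div_atTop_nhds_zero_nat (c : ℝ)).const_sub 1).sub ha).mul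
      (tendsto_cumEuler_sub_div hτ hτ1 ha (c + 1) 0))
    convert! h using 2
    unfold tiltedMean
    field_simp
    ring
  have hinv := hlim.inv₀ (by positivity)
  rw [inv_div] at hinv
  refine hinv.congr' ?_
  filter_upwards [eventually_ge_atTop (c + 1),
    (tendsto_atTop_of_div hα ha).eventually (eventually_ge_atTop 1)] with n hn hi
  have hn0 : (n : ℝ) ≠ 0 := by
    have : 0 < n := by omega
    positivity
  obtain ⟨m, rfl⟩ : ∃ m, n = m + c + 1 := ⟨n - (c + 1), by omega⟩
  obtain ⟨b, hb⟩ : ∃ b, a (m + c + 1) = b + 1 := ⟨a (m + c + 1) - 1, by omega⟩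
  have hrec := cumEuler_succ_succ m b
  have hp := cumEuler_pos m b
  rw [hb, show m + c + 1 - (c + 1) = m by omega, show m + c + 1 - c = m + 1 by omega, hrec,
    Nat.add_sub_cancel, inv_eq_iff_eq_inv, inv_div]
  field_simp
  push_cast
  ring

lemma tendsto_pow_mul_cumEuler_div (hτ : 0 < τ) (hτ1 : tiltedMean τ < 1)
    (ha : Tendsto (fun n => (a n : ℝ) / n) atTop (nhds (1 - tiltedMean τ))) (c i : ℕ) :
    Tendsto (fun n : ℕ => (n : ℝ) ^ c * cumEuler (n - c) (a n - i) / cumEuler n (a n)) atTop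
      (nhds ((τ / (1 - Real.exp (-τ))) ^ c * Real.exp (-τ) ^ i)) := by
  have hα : 0 < 1 - tiltedMean τ := by linarith
  have hpos : ∀ i : ℕ, ∀ᶠ n in atTop, ∀ m, cumEuler m (a n - i) ≠ 0 := by
    intro i
    filter_upwards [(tendsto_atTop_of_div hα ha).eventually (eventually_ge_atTop (i + 1))]
      with n hn m
    rw [show a n - i = a n - i - 1 + 1 by omega]
    exact (cumEuler_pos _ _).ne'
  induction i with
  | zero =>
    induction c with
    | zero =>
      simp only [pow_zero, one_mul, Nat.sub_zero]
      refine tendsto_const_nhds.congr' ?_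
      filter_upwards [hpos 0] with n hn
      exact (div_self (hn n)).symm
    | succ c ih =>
      have h := ih.mul (tendsto_mul_cumEuler_div hτ hτ1 ha c)
      rw [mul_right_comm, ← pow_succ] at h
      refine h.congr' ?_
      filter_upwards [hpos 0] with n hn
      have h1 := hn n
      have h2 := hn (n - c)
      simp only [Nat.sub_zero] at *
      field_simp
      ring
  | succ i ih =>
    have h := ih.mul (tendsto_cumEuler_sub_div hτ hτ1 ha c i)
    rw [mul_assoc, ← pow_succ] at h
    refine h.congr' ?_
    filter_upwards [hpos 0, hpos i] with n hn hi
    have h1 := hn n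
    have h2 := hi (n - c)
    simp only [Nat.sub_zero] at *
    field_simp

/-- The normalized `j`-th difference `n ^ j ∇^j H_{n-j}(a) / H_n(a)` for `H = cumEuler`. -/
noncomputable def relDiff (n j a : ℕ) : ℝ :=
  (n : ℝ) ^ j * (bdiff ^ j) (cumEuler (n - j)) a / cumEuler n a

/-- Up to the normalization, the `j`-th difference is the `j`-th derivative of the distribution
function of a sum of `n` uniform variables, hence the factor `τ ^ j`. -/
lemma tendsto_relDiff (hτ : 0 < τ) (hτ1 : tiltedMean τ < 1)
    (ha : Tendsto (fun n => (a n : ℝ) / n) atTop (nhds (1 - tiltedMean τ))) (j : ℕ) :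
    Tendsto (fun n => relDiff n j (a n)) atTop (nhds (τ ^ j)) := by
  have hα : 0 < 1 - tiltedMean τ := by linarith
  have h1 := one_sub_exp_neg_pos hτ
  have key : ∀ j c i : ℕ, Tendsto (fun n : ℕ =>
      (n : ℝ) ^ c * (bdiff ^ j) (cumEuler (n - c)) (a n - i) / cumEuler n (a n)) atTop
      (nhds ((1 - Real.exp (-τ)) ^ j * (τ / (1 - Real.exp (-τ))) ^ c * Real.exp (-τ) ^ i)) := by
    intro j c
    induction j with
    | zero =>
      intro i
      simpa using tendsto_pow_mul_cumEuler_div hτ hτ1 ha c i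
    | succ j ih =>
      intro i
      have h := (ih i).sub (ih (i + 1))
      have e : (1 - Real.exp (-τ)) ^ j * (τ / (1 - Real.exp (-τ))) ^ c * Real.exp (-τ) ^ i -
          (1 - Real.exp (-τ)) ^ j * (τ / (1 - Real.exp (-τ))) ^ c * Real.exp (-τ) ^ (i + 1) =
          (1 - Real.exp (-τ)) ^ (j + 1) * (τ / (1 - Real.exp (-τ))) ^ c * Real.exp (-τ) ^ i := by
        ring
      rw [e] at h
      refine h.congr' ?_
      filter_upwards [(tendsto_atTop_of_div hα ha).eventually (eventually_ge_atTop (i + 1))]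
        with n hn
      rw [show a n - i = a n - (i + 1) + 1 by omega, bdiff_pow_succ_apply]
      ring
  have h := key j j 0
  rw [pow_zero, mul_one, ← mul_pow, mul_div_cancel₀ _ h1.ne'] at h
  exact h

lemma pow_mul_factorial_le {n j : ℕ} (hj : j ≤ n) :
    n ^ j * j.factorial ≤ n.descFactorial j * j ^ j := by
  rw [← Nat.descFactorial_self, Nat.descFactorial_eq_prod_range, Nat.descFactorial_eq_prod_range,
    ← Finset.card_range j, ← Finset.prod_const, ← Finset.prod_const, Finset.card_range,
    ← Finset.prod_mul_distrib, ← Finset.prod_mul_distrib]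
  refine Finset.prod_le_prod' fun i hi => ?_
  rw [Nat.mul_sub, Nat.sub_mul, Nat.mul_comm i j]
  have : j * i ≤ n * i := Nat.mul_le_mul_right i hj
  omega

lemma pow_le_exp_mul_descFactorial {n j : ℕ} (hj : j ≤ n) :
    (n : ℝ) ^ j ≤ Real.exp 1 ^ j * n.descFactorial j := by
  have h1 : (n : ℝ) ^ j * j.factorial ≤ n.descFactorial j * (j : ℝ) ^ j := by
    exact_mod_cast pow_mul_factorial_le hj
  have h2 := Real.pow_div_factorial_le_exp (j : ℝ) (by positivity) j
  rw [div_le_iff₀ (by positivity)] at h2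
  rw [← Real.exp_nat_mul, mul_one]
  refine le_of_mul_le_mul_right (a := (j.factorial : ℝ)) ?_ (by positivity)
  calc _ ≤ n.descFactorial j * (j : ℝ) ^ j := h1
    _ ≤ n.descFactorial j * (Real.exp j * j.factorial) := by gcongr
    _ = _ := by ring

lemma mul_cumEuler_le {ε : ℝ} (hε1 : ε ≤ 1) {m k : ℕ} (hk : ε * (m + 1) ≤ k) :
    ε * (m + 1) * cumEuler m k ≤ cumEuler (m + 1) k := by
  rcases Nat.lt_or_ge (m + 1) k with h | h
  · rw [cumEuler_of_le (by omega), cumEuler_of_le h.le, Nat.factorial_succ]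
    push_cast
    have : (0 : ℝ) ≤ (m + 1) * m.factorial := by positivity
    nlinarith
  cases k with
  | zero =>
    rw [cumEuler_succ_zero]
    refine mul_nonpos_of_nonpos_of_nonneg (by simpa using hk) (cumEuler_nonneg _ _)
  | succ k =>
    rw [cumEuler_succ_succ]
    have h1 : (k : ℝ) ≤ m := by exact_mod_cast (by omega : k ≤ m)
    have h2 := mul_le_mul_of_nonneg_right hk (cumEuler_nonneg m (k + 1))
    have h3 := mul_nonneg (sub_nonneg.2 h1) (cumEuler_nonneg m k)
    push_cast at h2
    linarith

lemma descFactorial_mul_cumEuler_le {ε : ℝ} (hε : 0 < ε) (hε1 : ε ≤ 1) {n k : ℕ} (hk : ε * n ≤ k)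
    {j : ℕ} (hj : j ≤ n) :
    ε ^ j * n.descFactorial j * cumEuler (n - j) k ≤ cumEuler n k := by
  induction j with
  | zero => simp
  | succ j ih =>
    have h := ih (by omega)
    obtain ⟨m, rfl⟩ : ∃ m, n = m + j + 1 := ⟨n - (j + 1), by omega⟩
    have h1 := mul_cumEuler_le hε1 (m := m) (k := k) (by
      refine le_trans ?_ hk
      push_cast
      have : (0 : ℝ) ≤ j := by positivity
      nlinarith)
    refine le_trans ?_ h
    rw [Nat.descFactorial_succ, show m + j + 1 - (j + 1) = m by omega,
      show m + j + 1 - j = m + 1 by omega]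
    have h2 := mul_le_mul_of_nonneg_left h1
      (by positivity : 0 ≤ ε ^ j * ((m + j + 1).descFactorial j : ℝ))
    refine le_trans (le_of_eq ?_) h2
    push_cast
    ring

/-- A bound uniform in `n`: the difference has `2 ^ j` terms (with multiplicity), lowering the index
from `m + 1` to `m` costs a factor `1 / (ε (m + 1))` at most by the recurrence, and
`n ^ j (n - j)! / n ! ≤ exp j`. -/
lemma abs_relDiff_le {ε : ℝ} (hε : 0 < ε) (hε1 : ε ≤ 1) {n k : ℕ} (hk : ε * n ≤ k) (hk0 : 0 < k)
    {j : ℕ} (hj : j ≤ n) : |relDiff n j k| ≤ (2 * Real.exp 1 / ε) ^ j := by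
  have hpos : 0 < cumEuler n k := by
    obtain ⟨k, rfl⟩ : ∃ k', k = k' + 1 := ⟨k - 1, by omega⟩
    exact cumEuler_pos n k
  have h1 : |(bdiff ^ j) (cumEuler (n - j)) k| ≤ 2 ^ j * cumEuler (n - j) k :=
    abs_bdiff_pow_le (fun i hi => by
      rw [abs_of_nonneg (cumEuler_nonneg _ _)]; exact cumEuler_mono _ hi) j
  have h2 := descFactorial_mul_cumEuler_le hε hε1 hk hj
  have h3 := pow_le_exp_mul_descFactorial hj
  have h4 := cumEuler_nonneg (n - j) k
  unfold relDiff
  rw [abs_div, abs_mul, abs_of_pos hpos, abs_of_nonneg (by positivity : (0 : ℝ) ≤ (n : ℝ) ^ j),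
    div_le_iff₀ hpos]
  calc (n : ℝ) ^ j * |(bdiff ^ j) (cumEuler (n - j)) k|
      ≤ (Real.exp 1 ^ j * n.descFactorial j) * (2 ^ j * cumEuler (n - j) k) := by gcongr
    _ = (2 * Real.exp 1 / ε) ^ j * (ε ^ j * n.descFactorial j * cumEuler (n - j) k) := by
        rw [div_pow, mul_pow]; field_simp
    _ ≤ _ := by gcongr

end Differences

/-- The factor `exp (± t_x t_y / 2)`: the `j`-th term of the joint distribution function, relative
to the product of the marginals, converges to `(s τ τ' / 2) ^ j / j!`. -/
theorem tendsto_jointSum_div {τ τ' s : ℝ} {a b : ℕ → ℕ} (hs : |s| ≤ 1)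
    (hτ : 0 < τ) (hτ1 : tiltedMean τ < 1) (hτ' : 0 < τ') (hτ1' : tiltedMean τ' < 1)
    (ha : Tendsto (fun n => (a n : ℝ) / n) atTop (nhds (1 - tiltedMean τ)))
    (hb : Tendsto (fun n => (b n : ℝ) / n) atTop (nhds (1 - tiltedMean τ'))) :
    Tendsto (fun n => jointSum n s (a n) (b n) / (cumEuler n (a n) * cumEuler n (b n))) atTop
      (nhds (Real.exp (s * (τ * τ') / 2))) := by
  set f : ℕ → ℕ → ℝ := fun n j =>
    s ^ j * stirlingWeight n j * (relDiff n j (a n) * relDiff n j (b n)) with hf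
  set α := 1 - tiltedMean τ with hα
  set α' := 1 - tiltedMean τ' with hα'
  have hα0 : 0 < α := by linarith
  have hα0' : 0 < α' := by linarith
  obtain ⟨ε, hε, hε'⟩ := exists_between (lt_min one_pos (lt_min hα0 hα0'))
  obtain ⟨hε1, hε2⟩ := lt_min_iff.1 hε'
  obtain ⟨hεα, hεα'⟩ := lt_min_iff.1 hε2
  set B := 1 / 2 * (2 * Real.exp 1 / ε) ^ 2 with hB
  have hlim : Tendsto (fun n => ∑' j, f n j) atTop
      (nhds (∑' j : ℕ, (s * (τ * τ') / 2) ^ j / j.factorial)) := by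
    refine tendsto_tsum_of_dominated_convergence (bound := fun j => B ^ j / j.factorial)
      (Real.summable_pow_div_factorial B) ?_ ?_
    · intro j
      have h := ((tendsto_stirlingWeight j).const_mul (s ^ j)).mul
        ((tendsto_relDiff hτ hτ1 ha j).mul (tendsto_relDiff hτ' hτ1' hb j))
      convert! h using 2
      rw [div_pow, mul_pow, mul_pow, div_pow, one_pow]
      ring
    · filter_upwards [ha.eventually (lt_mem_nhds hεα), hb.eventually (lt_mem_nhds hεα'),
        (tendsto_atTop_of_div hα0 ha).eventually (eventually_gt_atTop 0),
        (tendsto_atTop_of_div hα0' hb).eventually (eventually_gt_atTop 0),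
        eventually_gt_atTop 0] with n h1 h2 h3 h4 hn j
      have hn0 : (0 : ℝ) < n := by exact_mod_cast hn
      rw [lt_div_iff₀ hn0] at h1 h2
      rcases Nat.lt_or_ge n j with hj | hj
      · simp only [hf, stirlingWeight, esymmRange_eq_zero hj]
        simp only [Nat.cast_zero, zero_div, mul_zero, zero_mul, norm_zero]
        positivity
      have e1 := abs_relDiff_le hε hε1.le h1.le h3 hj
      have e2 := abs_relDiff_le hε hε1.le h2.le h4 hj
      have e3 : |s| ^ j ≤ 1 := pow_le_one₀ (abs_nonneg _) hs
      have e4 := stirlingWeight_le n j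
      have e5 := stirlingWeight_nonneg n j
      simp only [hf, Real.norm_eq_abs, abs_mul, abs_pow]
      rw [abs_of_nonneg e5]
      calc _ ≤ 1 * ((1 / 2) ^ j / j.factorial) *
            ((2 * Real.exp 1 / ε) ^ j * (2 * Real.exp 1 / ε) ^ j) := by gcongr
        _ = _ := by rw [hB, mul_pow, sq, mul_pow]; ring
  have hexp : ∑' j : ℕ, (s * (τ * τ') / 2) ^ j / (j.factorial : ℝ) =
      Real.exp (s * (τ * τ') / 2) := by
    rw [Real.exp_eq_exp_ℝ, NormedSpace.exp_eq_tsum_div]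
  rw [hexp] at hlim
  refine hlim.congr' ?_
  filter_upwards [eventually_gt_atTop 0] with n hn
  have hn0 : (n : ℝ) ≠ 0 := by positivity
  rw [tsum_eq_sum (s := Finset.range (n + 1)), jointSum, Finset.sum_div]
  · refine Finset.sum_congr rfl fun j _ => ?_
    simp only [hf, stirlingWeight, relDiff]
    rw [two_mul, pow_add]
    field_simp
  · intro j hj
    rw [Finset.mem_range, not_lt] at hj
    simp [hf, stirlingWeight, esymmRange_eq_zero (show n < j by omega)]

/-! ### Uniform random permutations -/

lemma IsUniformPerm.measureReal_eq {Ω : Type*} [MeasurableSpace Ω] {μ : Measure Ω} {n : ℕ}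
    {π : Ω → Equiv.Perm (Fin n)} (h : IsUniformPerm μ π) (p : Equiv.Perm (Fin n) → Prop)
    [DecidablePred p] :
    μ.real {ω | p (π ω)} = (Finset.univ.filter p).card / n.factorial := by
  have hset : {ω | p (π ω)} = ⋃ σ ∈ Finset.univ.filter p, π ⁻¹' {σ} := by
    ext ω; simp
  rw [Measure.real, hset, measure_biUnion_finset]
  · simp only [(h _).2, Finset.sum_const, nsmul_eq_mul]
    rw [ENNReal.toReal_mul, ENNReal.toReal_inv, ENNReal.toReal_natCast, ENNReal.toReal_natCast,
      div_eq_mul_inv]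
  · intro σ _ τ _ hστ
    exact Disjoint.preimage _ (Set.disjoint_singleton.2 hστ)
  · exact fun σ _ => (h σ).1

/-- The number `a` for which the events `D_n / (n - 1) ≤ 1 - x` and `D_n / (n - 1) ≥ x` become
`D_n < a` and `D_n ≥ n - a`. -/
noncomputable def descentCut (x : ℝ) (n : ℕ) : ℕ := ⌊(1 - x) * ((n : ℝ) - 1)⌋₊ + 1

section Cut

variable {x : ℝ} {n : ℕ}

lemma descentCut_le (hx : x ∈ Set.Ioo (1 / 2 : ℝ) 1) (hn : 2 ≤ n) : descentCut x n ≤ n := by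
  have hn' : (2 : ℝ) ≤ n := by exact_mod_cast hn
  have h1 : (1 - x) * ((n : ℝ) - 1) ≤ ((n - 1 : ℕ) : ℝ) := by
    rw [Nat.cast_sub (by omega), Nat.cast_one]
    have := hx.1
    nlinarith
  have h2 := Nat.floor_le_of_le h1
  unfold descentCut
  omega

lemma descentRatio_le_iff (hx : x ∈ Set.Ioo (1 / 2 : ℝ) 1) (hn : 2 ≤ n)
    (σ : Equiv.Perm (Fin n)) : descentRatio σ ≤ 1 - x ↔ descents σ < descentCut x n := by
  have hn' : (0 : ℝ) < (n : ℝ) - 1 := by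
    have : (2 : ℝ) ≤ n := by exact_mod_cast hn
    linarith
  have hx' : 0 < 1 - x := by linarith [hx.2]
  rw [descentRatio, div_le_iff₀ hn', descentCut, Nat.lt_succ_iff, Nat.le_floor_iff (by positivity)]

lemma le_descentRatio_iff (hx : x ∈ Set.Ioo (1 / 2 : ℝ) 1) (hn : 2 ≤ n)
    (σ : Equiv.Perm (Fin n)) : x ≤ descentRatio σ ↔ n - descentCut x n ≤ descents σ := by
  have hn' : (0 : ℝ) < (n : ℝ) - 1 := by
    have : (2 : ℝ) ≤ n := by exact_mod_cast hn
    linarith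
  have hx' : 0 < 1 - x := by linarith [hx.2]
  have hd := descents_lt (by omega) σ
  have h1 : x ≤ descentRatio σ ↔ n - 1 - descents σ ≤ ⌊(1 - x) * ((n : ℝ) - 1)⌋₊ := by
    rw [descentRatio, le_div_iff₀ hn', Nat.le_floor_iff (by positivity), Nat.cast_sub (by omega),
      Nat.cast_sub (by omega), Nat.cast_one]
    constructor <;> intro h <;> linarith
  rw [h1, descentCut]
  omega

lemma tendsto_descentCut_div (hx : x ∈ Set.Ioo (1 / 2 : ℝ) 1) :
    Tendsto (fun n => (descentCut x n : ℝ) / n) atTop (nhds (1 - x)) := by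
  have hx' : 0 < 1 - x := by linarith [hx.2]
  have hlow : Tendsto (fun n : ℕ => (1 - x) - (1 - x) / n) atTop (nhds (1 - x)) := by
    simpa using (tendsto_const_div_atTop_nhds_zero_nat (1 - x)).const_sub (1 - x)
  have hhigh : Tendsto (fun n : ℕ => (1 - x) + 1 / n) atTop (nhds (1 - x)) := by
    simpa using (tendsto_const_div_atTop_nhds_zero_nat (1 : ℝ)).const_add (1 - x)
  refine tendsto_of_tendsto_of_tendsto_of_le_of_le' hlow hhigh ?_ ?_
  · filter_upwards [eventually_gt_atTop 0] with n hn
    have hn0 : (0 : ℝ) < n := by exact_mod_cast hn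
    have h := Nat.lt_floor_add_one ((1 - x) * ((n : ℝ) - 1))
    rw [le_div_iff₀ hn0, sub_mul, div_mul_cancel₀ _ hn0.ne', descentCut]
    push_cast
    linarith
  · filter_upwards [eventually_gt_atTop 0] with n hn
    have hn0 : (0 : ℝ) < n := by exact_mod_cast hn
    have hn1 : (1 : ℝ) ≤ n := by exact_mod_cast hn
    have h := Nat.floor_le (mul_nonneg hx'.le (sub_nonneg.2 hn1))
    rw [div_le_iff₀ hn0, add_mul, div_mul_cancel₀ _ hn0.ne', descentCut]
    push_cast
    linarith

end Cut

/-- The asymptotic relation for one of the four corners: `u` stands for the joint probability, `v`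
and `w` for the marginals. -/
lemma isEquivalent_of_eq_jointSum {x y tx ty s : ℝ} (hs : |s| ≤ 1)
    (hx : x ∈ Set.Ioo (1 / 2 : ℝ) 1) (hy : y ∈ Set.Ioo (1 / 2 : ℝ) 1) (htx : 0 < tx)
    (hty : 0 < ty) (htx' : tiltedMean tx = x) (hty' : tiltedMean ty = y) {u v w : ℕ → ℝ}
    (hu : ∀ᶠ n in atTop, (n.factorial : ℝ) * (u n * n.factorial) =
      jointSum n s (descentCut x n) (descentCut y n))
    (hv : ∀ᶠ n in atTop, v n * n.factorial = cumEuler n (descentCut x n))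
    (hw : ∀ᶠ n in atTop, w n * n.factorial = cumEuler n (descentCut y n)) :
    u ~[atTop] fun n => v n * w n * Real.exp (s * (tx * ty) / 2) := by
  have hcx := tendsto_descentCut_div hx
  have hcy := tendsto_descentCut_div hy
  rw [← htx'] at hcx
  rw [← hty'] at hcy
  have hlim := (tendsto_jointSum_div hs htx (by rw [htx']; exact hx.2) hty
    (by rw [hty']; exact hy.2) hcx hcy).div_const (Real.exp (s * (tx * ty) / 2))
  rw [div_self (Real.exp_ne_zero _), htx', hty'] at hlim
  rw [isEquivalent_iff_exists_eq_mul]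
  refine ⟨_, hlim, ?_⟩
  filter_upwards [hu, hv, hw] with n hu hv hw
  have h1 : 0 < cumEuler n (descentCut x n) := cumEuler_pos _ _
  have h2 : 0 < cumEuler n (descentCut y n) := cumEuler_pos _ _
  have hf : (n.factorial : ℝ) ≠ 0 := by positivity
  simp only [Pi.mul_apply]
  rw [← hu, ← hv, ← hw]
  have h3 : v n ≠ 0 := fun h => by rw [h, zero_mul] at hv; exact h1.ne hv
  have h4 : w n ≠ 0 := fun h => by rw [h, zero_mul] at hw; exact h2.ne hw
  have h5 := Real.exp_ne_zero (s * (tx * ty) / 2)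
  field_simp

theorem corollary4p3 {Ω : ℕ → Type*} [∀ n, MeasurableSpace (Ω n)] (μ : ∀ n, Measure (Ω n))
    (π : ∀ n, Ω n → Equiv.Perm (Fin n)) (hπ : ∀ n, 1 ≤ n → IsUniformPerm (μ n) (π n))
    (x y : ℝ) (hx : x ∈ Set.Ioo (1 / 2 : ℝ) 1) (hy : y ∈ Set.Ioo (1 / 2 : ℝ) 1) :
    ∃ tx ty : ℝ,
      (∀ t : ℝ, HasDerivAt logLaplaceUnif x t ↔ t = tx) ∧
      (∀ t : ℝ, HasDerivAt logLaplaceUnif y t ↔ t = ty) ∧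
      ((fun n : ℕ => (μ n).real
          {ω | x ≤ descentRatio (π n ω) ∧ y ≤ descentRatio ((π n ω)⁻¹)})
        ~[atTop] fun n : ℕ =>
          (μ n).real {ω | x ≤ descentRatio (π n ω)} *
            (μ n).real {ω | y ≤ descentRatio ((π n ω)⁻¹)} * Real.exp (tx * ty / 2)) ∧
      ((fun n : ℕ => (μ n).real
          {ω | descentRatio (π n ω) ≤ 1 - x ∧ descentRatio ((π n ω)⁻¹) ≤ 1 - y})
        ~[atTop] fun n : ℕ =>
          (μ n).real {ω | descentRatio (π n ω) ≤ 1 - x} *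
            (μ n).real {ω | descentRatio ((π n ω)⁻¹) ≤ 1 - y} * Real.exp (tx * ty / 2)) ∧
      ((fun n : ℕ => (μ n).real
          {ω | descentRatio (π n ω) ≤ 1 - x ∧ y ≤ descentRatio ((π n ω)⁻¹)})
        ~[atTop] fun n : ℕ =>
          (μ n).real {ω | descentRatio (π n ω) ≤ 1 - x} *
            (μ n).real {ω | y ≤ descentRatio ((π n ω)⁻¹)} * Real.exp (-(tx * ty / 2))) ∧
      ((fun n : ℕ => (μ n).real
          {ω | x ≤ descentRatio (π n ω) ∧ descentRatio ((π n ω)⁻¹) ≤ 1 - y})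
        ~[atTop] fun n : ℕ =>
          (μ n).real {ω | x ≤ descentRatio (π n ω)} *
            (μ n).real {ω | descentRatio ((π n ω)⁻¹) ≤ 1 - y} * Real.exp (-(tx * ty / 2))) := by
  obtain ⟨tx, htx, htx', htxu⟩ := exists_unique_deriv_logLaplaceUnif hx
  obtain ⟨ty, hty, hty', htyu⟩ := exists_unique_deriv_logLaplaceUnif hy
  have hcard : ∀ n, 2 ≤ n → ∀ (p : Equiv.Perm (Fin n) → Prop) [DecidablePred p],
      (μ n).real {ω | p (π n ω)} * n.factorial = (Finset.univ.filter p).card := by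
    intro n hn p _
    rw [(hπ n (by omega)).measureReal_eq p, div_mul_cancel₀ _ (by positivity)]
  have hev : ∀ᶠ n : ℕ in atTop, 2 ≤ n := eventually_ge_atTop 2
  have v1 : ∀ᶠ n : ℕ in atTop, (μ n).real {ω | x ≤ descentRatio (π n ω)} * n.factorial =
      cumEuler n (descentCut x n) := by
    filter_upwards [hev] with n hn
    simp only [le_descentRatio_iff hx hn]
    rw [hcard n hn (fun σ => n - descentCut x n ≤ descents σ),
      card_le_descents (by omega) (descentCut_le hx hn)]
  have v2 : ∀ᶠ n : ℕ in atTop, (μ n).real {ω | descentRatio (π n ω) ≤ 1 - x} * n.factorial =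
      cumEuler n (descentCut x n) := by
    filter_upwards [hev] with n hn
    simp only [descentRatio_le_iff hx hn]
    rw [hcard n hn (fun σ => descents σ < descentCut x n), card_descents_lt (by omega)]
  have w1 : ∀ᶠ n : ℕ in atTop, (μ n).real {ω | y ≤ descentRatio (π n ω)⁻¹} * n.factorial =
      cumEuler n (descentCut y n) := by
    filter_upwards [hev] with n hn
    simp only [le_descentRatio_iff hy hn]
    rw [hcard n hn (fun σ => n - descentCut y n ≤ descents σ⁻¹),
      card_le_descents_inv (by omega) (descentCut_le hy hn)]
  have w2 : ∀ᶠ n : ℕ in atTop, (μ n).real {ω | descentRatio (π n ω)⁻¹ ≤ 1 - y} * n.factorial =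
      cumEuler n (descentCut y n) := by
    filter_upwards [hev] with n hn
    simp only [descentRatio_le_iff hy hn]
    rw [hcard n hn (fun σ => descents σ⁻¹ < descentCut y n), card_descents_inv_lt (by omega)]
  have h1 : |(1 : ℝ)| ≤ 1 := by simp
  have h2 : |(-1 : ℝ)| ≤ 1 := by simp
  refine ⟨tx, ty, htxu, htyu, ?_, ?_, ?_, ?_⟩
  · rw [← one_mul (tx * ty)]
    refine isEquivalent_of_eq_jointSum h1 hx hy htx hty htx' hty' ?_ v1 w1
    filter_upwards [hev] with n hn
    simp only [le_descentRatio_iff hx hn, le_descentRatio_iff hy hn]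
    rw [hcard n hn (fun σ => n - descentCut x n ≤ descents σ ∧ n - descentCut y n ≤ descents σ⁻¹)]
    exact factorial_mul_card_descents_le_le (by omega) (descentCut_le hx hn) (descentCut_le hy hn)
  · rw [← one_mul (tx * ty)]
    refine isEquivalent_of_eq_jointSum h1 hx hy htx hty htx' hty' ?_ v2 w2
    filter_upwards [hev] with n hn
    simp only [descentRatio_le_iff hx hn, descentRatio_le_iff hy hn]
    rw [hcard n hn (fun σ => descents σ < descentCut x n ∧ descents σ⁻¹ < descentCut y n)]
    exact factorial_mul_card_descents_lt_lt (by omega) _ _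
  · rw [← neg_div, ← neg_one_mul (tx * ty)]
    refine isEquivalent_of_eq_jointSum h2 hx hy htx hty htx' hty' ?_ v2 w1
    filter_upwards [hev] with n hn
    simp only [descentRatio_le_iff hx hn, le_descentRatio_iff hy hn]
    rw [hcard n hn (fun σ => descents σ < descentCut x n ∧ n - descentCut y n ≤ descents σ⁻¹)]
    exact factorial_mul_card_descents_lt_le (by omega) _ (descentCut_le hy hn)
  · rw [← neg_div, ← neg_one_mul (tx * ty)]
    refine isEquivalent_of_eq_jointSum h2 hx hy htx hty htx' hty' ?_ v1 w2
    filter_upwards [hev] with n hn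
    simp only [le_descentRatio_iff hx hn, descentRatio_le_iff hy hn]
    rw [hcard n hn (fun σ => n - descentCut x n ≤ descents σ ∧ descents σ⁻¹ < descentCut y n)]
    exact factorial_mul_card_descents_le_lt (by omega) (descentCut_le hx hn) _
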